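/- **Setting.** Let $N=G\sqcup L$ be the finite set of buses ($G$ with inertia, $L$ without), let $(N,E)$ and $(N,\tilde E)$ be connected graphs whose edges carry an arbitrary direction, and let $M_j,B_{ij},\gamma_j,\gamma_{ij}>0$, $p^L_j,p^{nom}_{ij}\in\mathbb R$. Consider $$\dot\eta_{ij}=\omega_i-\omega_j,\quad p_{ij}=B_{ij}\sin\eta_{ij}-p^{nom}_{ij}\quad((i,j)\in E),$$ $$M_j\dot\omega_j=-p^L_j+s_j-d^u_j-\sum_{k:j\to k}p_{jk}+\sum_{i:i\to j}p_{ij}\ (j\in G),\qquad 0=-p^L_j+s_j-d^u_j-\sum_{k:j\to k}p_{jk}+\sum_{i:i\to j}p_{ij}\ (j\in L),$$ $$\gamma_{ij}\dot\psi_{ij}=p^c_i-p^c_j\ ((i,j)\in\tilde E),\qquad \gamma_j\dot p^c_j=-(s_j-p^L_j)-\sum_{k:j\to k}\psi_{jk}+\sum_{i:i\to j}\psi_{ij}\ (j\in N),$$ where $s_j=p^M_j-d^c_j$ for $j\in G$ and $s_j=-d^c_j$ for $j\in L$. Here $p^M_j$ ($j\in G$) and $d^c_j$ ($j\in N$) are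 the outputs of systems $\dot x=f(x,u)$, $y=g(x,u)$ with input $\zeta_j=(-\omega_j,p^c_j)$ and states $x^{M,j},x^{c,j}$, and $-d^u_j$ ($j\in N$) is the output of such a system with input $-\omega_j$ and state $x^{u,j}$. In all these systems the state space is some $\mathbb R^n$, $f$ is locally Lipschitz, $g$ is continuous, and each constant input $\bar u$ has a unique equilibrium $k_x(\bar u)$, which is locally asymptotically stable; $k_y(\bar u)=g(k_x(\bar u),\bar u)$ is the static input-output map. The OSLC problem is to minimise $\sum_{j\in G}C_j(p^M_j)+\sum_{j\in N}C_{dj}(d^c_j)$ subject to $\sum_{j\in G}p^M_j=\sum_{j\in N}(d^c_j+p^L_j)$, $p^{M,min}_j\le p^M_j\le p^{M,max}_j$ and $d^{c,min}_j\le d^c_j\le d^{c,max}_j$. **Theorem.** Let $\beta^*=(\eta^*,\psi^*,\omega^*,x^{M,*},x^{c,*},x^{u,*},p^{c,*})$ be an equilibrium of this system. Assume: 1. All $C_j$, $C_{dj}$ are continuously differentiable and strictly convex on $\mathbb R$. 2. $|\eta^*_{ij}|<\pi/2$ for all $(i,j)\in E$. 3. $\bar u\,k_{y}(\bar u)>0$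 for all $\bar u\ne0$, for the static map $k_y$ from $-\omega_j$ to $-d^u_j$, $j\in N$. 4. There are open neighbourhoods $T$ of $(\eta^*,\omega^{G,*},x^{c,*},x^{u,*},p^{c,*})$ and $W$ of $\omega^{L,*}$ and a locally Lipschitz map $f^L$ on $T$ such that for $(\eta,\omega^G,x^c,x^u,p^c)\in T$ and $\omega^L\in W$ the algebraic equations at the buses in $L$ hold if and only if $\omega^L=f^L(\eta,\omega^G,x^c,x^u,p^c)$. 5. For each $j\in N$ there are a function $\phi_j:\mathbb R^2\to\mathbb R$, open neighbourhoods of $\zeta_j^*$ and of the equilibrium state of bus $j$ (that is, of $(x^{M,j,*},x^{c,j,*},x^{u,j,*})$ if $j\in G$ and of $(x^{c,j,*},x^{u,j,*})$ if $j\in L$), and a continuously differentiable function $V_j$ of that state with a strict local minimum at the equilibrium state, such that for all inputs and states in these neighbourhoods $$\dot V_j\le (s_j-s_j^*)\big((p^c_j-p^{c,*}_j)-(\omega_j-\omega_j^*)\big)+(d^u_j-d^{u,*}_j)(\omega_j-\omega_j^*)-\phi_j(\zeta_j-\zeta_j^*),$$ and moreover either (a) $\phi_j$ is positive definite, or (b)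 $\phi_j\ge0$, $\phi_j(z)>0$ whenever $z_1\neq0$, and there is no trajectory of bus $j$ on $\mathbb R$, with its inputs and states in some fixed neighbourhood of their equilibrium values, along which $\omega_j$ and $s_j$ are constant and $p^c_j$ is a nonconstant finite sum of sinusoids $\sum_kA_k\sin(w_kt+\theta_k)$. 6. If (a) holds at no bus, then for each of the systems with outputs $p^M_j$ ($j\in G$) and $d^c_j$ ($j\in N$) some neighbourhood of its equilibrium state at $\beta^*$ is contained in the region of attraction of $k_x(\bar\zeta)$ under the constant input $\bar\zeta$, for all $\bar\zeta$ near $\zeta_j^*$. 7. There is a surjective $f:\mathbb R^2\to\mathbb R$, strictly increasing in its second argument $p^c_j$, such that for all $\zeta$ the static maps satisfy $k_{p^M_j}(\zeta)=\big[(C_j')^{-1}(f(\zeta))\big]_{p^{M,min}_j}^{p^{M,max}_j}$ ($j\in G$) and $k_{d^c_j}(\zeta)=\big[(C_{dj}')^{-1}(-f(\zeta))\big]_{d^{c,min}_j}^{d^{c,max}_j}$ ($j\in N$), all these inverse values being defined; here $[q]_a^b=\max\{\min\{q,b\},a\}$. Then there are an open neighbourhood $S$ of $\beta^*$ and a compact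 set $K\ni\beta^*$ of equilibria, each of which has $\omega=0$ and has values $(p^M,d^c)$ that solve the OSLC problem, such that: from every point of $S$ that satisfies the algebraic equations there starts a solution defined for all $t\ge0$; every solution on a bounded interval $[0,\tau)$ starting in $S$ extends to one on $[0,\infty)$; and every solution on $[0,\infty)$ starting in $S$ converges to $K$ as $t\to\infty$. -/

import Mathlib

open Set Filter Topology

noncomputable section

/-! ### Autonomous differential equations and asymptotic stability -/

/-- `x` solves `x' = F x` on the time set `I` (an interval). -/
def IsODESolution {X : Type*} [NormedAddCommGroup X] [NormedSpace ℝ X]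
    (F : X → X) (I : Set ℝ) (x : ℝ → X) : Prop :=
  ∀ t ∈ I, HasDerivWithinAt x (F (x t)) I t

/-- The region of attraction of `xbar` for `x' = F x`. -/
def regionOfAttraction {X : Type*} [NormedAddCommGroup X] [NormedSpace ℝ X]
    (F : X → X) (xbar : X) : Set X :=
  {x₀ | ∃ x : ℝ → X, IsODESolution F (Ici 0) x ∧ x 0 = x₀ ∧ Tendsto x atTop (𝓝 xbar)}

/-- Local asymptotic stability: Lyapunov stability (tested on every solution, also on those that
are only defined on a bounded time interval) together with local attractivity. -/
def IsLocallyAsymptoticallyStable {X : Type*} [NormedAddCommGroup X] [NormedSpace ℝ X]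
    (F : X → X) (xbar : X) : Prop :=
  (∀ ε > 0, ∃ δ > 0, ∀ (τ : ℝ) (x : ℝ → X), IsODESolution F (Ico 0 τ) x →
      dist (x 0) xbar < δ → ∀ t ∈ Ico 0 τ, dist (x t) xbar < ε) ∧
    regionOfAttraction F xbar ∈ 𝓝 xbar

/-! ### Input-output subsystems -/

/-- A subsystem `x' = f(x,u)`, `y = g(x,u)` with state in `ℝⁿ`, input in `U` and scalar output:
`f` is locally Lipschitz, `g` is continuous, and every constant input `u` has a unique equilibrium
`kx u`, which is locally asymptotically stable. -/
structure DynSys (U : Type) [NormedAddCommGroup U] where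
  /-- dimension of the state space -/
  n : ℕ
  f : (Fin n → ℝ) → U → (Fin n → ℝ)
  g : (Fin n → ℝ) → U → ℝ
  f_lipschitz : LocallyLipschitz (fun p : (Fin n → ℝ) × U => f p.1 p.2)
  g_continuous : Continuous (fun p : (Fin n → ℝ) × U => g p.1 p.2)
  /-- the static input-state characteristic -/
  kx : U → (Fin n → ℝ)
  equilibrium_iff : ∀ u x, f x u = 0 ↔ x = kx u
  stable : ∀ u, IsLocallyAsymptoticallyStable (fun x => f x u) (kx u)

namespace DynSys

variable {U : Type} [NormedAddCommGroup U]

/-- The state space of a subsystem. -/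
abbrev X (S : DynSys U) : Type := Fin S.n → ℝ

/-- The static input-output characteristic. -/
def ky (S : DynSys U) (u : U) : ℝ := S.g (S.kx u) u

/-- A single neighbourhood of the equilibrium state for the constant input `ubar` is contained in
the regions of attraction belonging to all constant inputs near `ubar`. -/
def HasCommonRegionOfAttraction (S : DynSys U) (ubar : U) : Prop :=
  ∃ X₀ ∈ 𝓝 (S.kx ubar), ∀ᶠ u in 𝓝 ubar, X₀ ⊆ regionOfAttraction (fun x => S.f x u) (S.kx u)

end DynSys

/-! ### Dissipativity -/

/-- The system `x' = F(x,u)`, `y = h(x,u)` is locally dissipative about the input `ubar` and the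
state `xbar` with supply rate `W`: there is a continuously differentiable storage function with a
strict local minimum at `xbar` (so that `V - V xbar` is positive definite about `xbar`) whose
derivative along the system is at most `W(u,y)`, near `ubar` and `xbar`. -/
def LocallyDissipative {X U Y : Type*} [NormedAddCommGroup X] [NormedSpace ℝ X]
    [TopologicalSpace U] (F : X → U → X) (h : X → U → Y) (ubar : U) (xbar : X)
    (W : U → Y → ℝ) : Prop :=
  ∃ (U₀ : Set U) (X₀ : Set X) (V : X → ℝ),
    IsOpen U₀ ∧ ubar ∈ U₀ ∧ IsOpen X₀ ∧ xbar ∈ X₀ ∧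
    ContDiff ℝ 1 V ∧ (∀ᶠ x in 𝓝[≠] xbar, V xbar < V x) ∧
    ∀ u ∈ U₀, ∀ x ∈ X₀, fderiv ℝ V x (F x u) ≤ W u (h x u)

/-- The supply rate
`[s - s*, (-dᵘ) - (-dᵘ*)] [[1, 1], [1, 0]] (ζ - ζ*) - φ(ζ - ζ*)`, with `ζ = (-ω, pᶜ)` and
`y = (s, -dᵘ)`. -/
def supplyRate (φ : ℝ × ℝ → ℝ) (ζs ys : ℝ × ℝ) (ζ y : ℝ × ℝ) : ℝ :=
  (y.1 - ys.1) * ((ζ.1 - ζs.1) + (ζ.2 - ζs.2)) + (y.2 - ys.2) * (ζ.1 - ζs.1) - φ (ζ - ζs)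

/-- A nontrivial sinusoid: a finite sum `∑ Aₖ sin (wₖ t + θₖ)` that is not constant. -/
def IsNontrivialSinusoid (p : ℝ → ℝ) : Prop :=
  (∃ (m : ℕ) (A w θ : Fin m → ℝ), ∀ t, p t = ∑ k, A k * Real.sin (w k * t + θ k)) ∧
    ¬ ∃ c : ℝ, ∀ t, p t = c

/-- Near the equilibrium, a trajectory (on all of `ℝ`) along which `ω` and `s` are constant cannot
have a nontrivial sinusoid as its power command. -/
def ExcludesSinusoids {X : Type*} [NormedAddCommGroup X] [NormedSpace ℝ X]
    (F : X → ℝ × ℝ → X) (h : X → ℝ × ℝ → ℝ × ℝ) (ζs : ℝ × ℝ) (xs : X) : Prop :=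
  ∃ U₀ ∈ 𝓝 ζs, ∃ X₀ ∈ 𝓝 xs, ∀ (x : ℝ → X) (ω : ℝ) (pc : ℝ → ℝ) (s : ℝ),
    (∀ t, HasDerivAt x (F (x t) (-ω, pc t)) t) →
    (∀ t, x t ∈ X₀ ∧ (-ω, pc t) ∈ U₀) →
    (∀ t, (h (x t) (-ω, pc t)).1 = s) →
    ¬ IsNontrivialSinusoid pc

/-- Dissipativity with a positive definite `φ`. -/
def DissipativityA {X : Type*} [NormedAddCommGroup X] [NormedSpace ℝ X]
    (F : X → ℝ × ℝ → X) (h : X → ℝ × ℝ → ℝ × ℝ) (ζs : ℝ × ℝ) (xs : X) : Prop :=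
  ∃ φ : ℝ × ℝ → ℝ, φ 0 = 0 ∧ (∀ z, z ≠ 0 → 0 < φ z) ∧
    LocallyDissipative F h ζs xs (supplyRate φ ζs (h xs ζs))

/-- Dissipativity with a positive semidefinite `φ` that is positive definite with respect to the
frequency component, together with the exclusion of sinusoidal power commands. -/
def DissipativityB {X : Type*} [NormedAddCommGroup X] [NormedSpace ℝ X]
    (F : X → ℝ × ℝ → X) (h : X → ℝ × ℝ → ℝ × ℝ) (ζs : ℝ × ℝ) (xs : X) : Prop :=
  (∃ φ : ℝ × ℝ → ℝ, (∀ z, 0 ≤ φ z) ∧ (∀ z, z.1 ≠ 0 → 0 < φ z) ∧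
    LocallyDissipative F h ζs xs (supplyRate φ ζs (h xs ζs))) ∧
  ExcludesSinusoids F h ζs xs

/-! ### The network -/

/-- A connected graph whose edges carry an arbitrary direction. -/
structure OrientedGraph (N : Type*) where
  edges : Finset (N × N)
  oriented : ∀ i j, (i, j) ∈ edges → (j, i) ∉ edges
  connected : (SimpleGraph.fromRel fun i j => (i, j) ∈ edges).Connected

/-- `- ∑_{k : j → k} x_{jk} + ∑_{i : i → j} x_{ij}`. -/
def OrientedGraph.netInflow {N : Type*} [DecidableEq N] (Γ : OrientedGraph N)
    (x : Γ.edges → ℝ) (j : N) : ℝ :=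
  - (∑ e : Γ.edges with e.1.1 = j, x e) + ∑ e : Γ.edges with e.1.2 = j, x e

/-- The data of the network, of the power command dynamics and of the supply and demand
dynamics. The buses with inertia are `G`, those without are `L`, and `G ⊕ L` is the set of all
buses. The input of `gen j` and `load j` is `ζ_j = (-ω_j, pᶜ_j)`, their outputs are `p^M_j` and
`dᶜ_j`; the input of `unc j` is `-ω_j` and its output is `-dᵘ_j`. -/
structure PowerNetwork (G L : Type) where
  line : OrientedGraph (G ⊕ L)
  B : line.edges → ℝ
  B_pos : ∀ e, 0 < B e
  pnom : line.edges → ℝ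
  M : G → ℝ
  M_pos : ∀ j, 0 < M j
  pL : G ⊕ L → ℝ
  comm : OrientedGraph (G ⊕ L)
  γ : G ⊕ L → ℝ
  γ_pos : ∀ j, 0 < γ j
  γe : comm.edges → ℝ
  γe_pos : ∀ e, 0 < γe e
  gen : G → DynSys (ℝ × ℝ)
  load : G ⊕ L → DynSys (ℝ × ℝ)
  unc : G ⊕ L → DynSys ℝ

namespace PowerNetwork

variable {G L : Type}

/-- The variables `(η, ψ, ω, x^M, xᶜ, xᵘ, pᶜ)`. -/
abbrev State (P : PowerNetwork G L) : Type :=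
  (P.line.edges → ℝ) × (P.comm.edges → ℝ) × (G ⊕ L → ℝ) × ((j : G) → (P.gen j).X) ×
    ((j : G ⊕ L) → (P.load j).X) × ((j : G ⊕ L) → (P.unc j).X) × (G ⊕ L → ℝ)

variable (P : PowerNetwork G L) (β : P.State)

abbrev η : P.line.edges → ℝ := β.1
abbrev ψ : P.comm.edges → ℝ := β.2.1
abbrev ω : G ⊕ L → ℝ := β.2.2.1
abbrev xM : (j : G) → (P.gen j).X := β.2.2.2.1
abbrev xc : (j : G ⊕ L) → (P.load j).X := β.2.2.2.2.1
abbrev xu : (j : G ⊕ L) → (P.unc j).X := β.2.2.2.2.2.1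
abbrev pc : G ⊕ L → ℝ := β.2.2.2.2.2.2

/-- `ζ_j = (-ω_j, pᶜ_j)`. -/
def ζ (j : G ⊕ L) : ℝ × ℝ := (-P.ω β j, P.pc β j)

/-- Generation `p^M_j`. -/
def pM (j : G) : ℝ := (P.gen j).g (P.xM β j) (P.ζ β (.inl j))

/-- Controllable demand `dᶜ_j`. -/
def dc (j : G ⊕ L) : ℝ := (P.load j).g (P.xc β j) (P.ζ β j)

/-- Uncontrollable frequency-dependent demand `dᵘ_j`. -/
def du (j : G ⊕ L) : ℝ := -(P.unc j).g (P.xu β j) (-P.ω β j)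

/-- Net supply: `s_j = p^M_j - dᶜ_j` on `G` and `s_j = -dᶜ_j` on `L`. -/
def s : G ⊕ L → ℝ
  | .inl j => P.pM β j - P.dc β (.inl j)
  | .inr j => -P.dc β (.inr j)

/-- Power transfers `p_{ij} = B_{ij} sin η_{ij} - p_{ij}^{nom}`. -/
def flow (e : P.line.edges) : ℝ := P.B e * Real.sin (P.η β e) - P.pnom e

/-- The right-hand side of the power balance at bus `j`; as `s_j` equals `p^M_j - dᶜ_j` on `G` and
`-dᶜ_j` on `L`, it is `M_j ω_j'` on `G`, and it vanishes on `L`. -/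
def balance [DecidableEq G] [DecidableEq L] (j : G ⊕ L) : ℝ :=
  -P.pL j + P.s β j - P.du β j + P.line.netInflow (P.flow β) j

/-- The right-hand side of the power command dynamics. -/
def commandBalance [DecidableEq G] [DecidableEq L] (j : G ⊕ L) : ℝ :=
  -(P.s β j - P.pL j) + P.comm.netInflow (P.ψ β) j

/-- The algebraic equations at the buses without inertia. -/
def AlgebraicEquations [DecidableEq G] [DecidableEq L] : Prop :=
  ∀ j : L, P.balance β (.inr j) = 0

/-- `β` is a solution of the interconnected system on the time interval `I`. -/
structure IsSolution [DecidableEq G] [DecidableEq L] (I : Set ℝ) (β : ℝ → P.State) : Prop where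
  η_deriv : ∀ t ∈ I, ∀ e : P.line.edges,
    HasDerivWithinAt (fun r => P.η (β r) e) (P.ω (β t) e.1.1 - P.ω (β t) e.1.2) I t
  ω_deriv : ∀ t ∈ I, ∀ j : G,
    HasDerivWithinAt (fun r => P.ω (β r) (.inl j)) (P.balance (β t) (.inl j) / P.M j) I t
  ω_cont : ∀ j : L, ContinuousOn (fun r => P.ω (β r) (.inr j)) I
  algebraic : ∀ t ∈ I, P.AlgebraicEquations (β t)
  xM_deriv : ∀ t ∈ I, ∀ j : G,
    HasDerivWithinAt (fun r => P.xM (β r) j)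
      ((P.gen j).f (P.xM (β t) j) (P.ζ (β t) (.inl j))) I t
  xc_deriv : ∀ t ∈ I, ∀ j : G ⊕ L,
    HasDerivWithinAt (fun r => P.xc (β r) j) ((P.load j).f (P.xc (β t) j) (P.ζ (β t) j)) I t
  xu_deriv : ∀ t ∈ I, ∀ j : G ⊕ L,
    HasDerivWithinAt (fun r => P.xu (β r) j) ((P.unc j).f (P.xu (β t) j) (-P.ω (β t) j)) I t
  ψ_deriv : ∀ t ∈ I, ∀ e : P.comm.edges,
    HasDerivWithinAt (fun r => P.ψ (β r) e)
      ((P.pc (β t) e.1.1 - P.pc (β t) e.1.2) / P.γe e) I t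
  pc_deriv : ∀ t ∈ I, ∀ j : G ⊕ L,
    HasDerivWithinAt (fun r => P.pc (β r) j) (P.commandBalance (β t) j / P.γ j) I t

/-- `β` is an equilibrium: the algebraic equations hold and all time derivatives vanish. -/
structure IsEquilibrium [DecidableEq G] [DecidableEq L] : Prop where
  η_eq : ∀ e : P.line.edges, P.ω β e.1.1 - P.ω β e.1.2 = 0
  ω_eq : ∀ j : G, P.balance β (.inl j) = 0
  algebraic : P.AlgebraicEquations β
  xM_eq : ∀ j, (P.gen j).f (P.xM β j) (P.ζ β (.inl j)) = 0
  xc_eq : ∀ j, (P.load j).f (P.xc β j) (P.ζ β j) = 0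
  xu_eq : ∀ j, (P.unc j).f (P.xu β j) (-P.ω β j) = 0
  ψ_eq : ∀ e : P.comm.edges, P.pc β e.1.1 - P.pc β e.1.2 = 0
  pc_eq : ∀ j, P.commandBalance β j = 0

/-- The variables `(η, ω^G, xᶜ, xᵘ, pᶜ)`. -/
abbrev ReducedState : Type :=
  (P.line.edges → ℝ) × (G → ℝ) × ((j : G ⊕ L) → (P.load j).X) ×
    ((j : G ⊕ L) → (P.unc j).X) × (G ⊕ L → ℝ)

/-- The components `(η, ω^G, xᶜ, xᵘ, pᶜ)` of `β`. -/
def reduced : P.ReducedState :=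
  (P.η β, fun j => P.ω β (.inl j), P.xc β, P.xu β, P.pc β)

/-- The components `ω^L` of `β`. -/
def ωL : L → ℝ := fun j => P.ω β (.inr j)

/-- Near `βs` the algebraic equations say exactly that `ω^L = f^L(η, ω^G, xᶜ, xᵘ, pᶜ)` for a
locally Lipschitz map `f^L`. -/
def HasLocalFrequencyMap [Fintype G] [Fintype L] [DecidableEq G] [DecidableEq L]
    (βs : P.State) : Prop :=
  ∃ (T : Set P.ReducedState) (W : Set (L → ℝ)) (fL : P.ReducedState → L → ℝ),
    IsOpen T ∧ P.reduced βs ∈ T ∧ IsOpen W ∧ P.ωL βs ∈ W ∧ LocallyLipschitzOn T fL ∧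
    ∀ β : P.State, P.reduced β ∈ T → P.ωL β ∈ W →
      (P.AlgebraicEquations β ↔ P.ωL β = fL (P.reduced β))

/-! ### The systems from `ζ_j` to `(s_j, -dᵘ_j)` at the buses -/

/-- State `(x^M, xᶜ, xᵘ)` at a bus with inertia. -/
abbrev GenBusState (j : G) : Type := (P.gen j).X × (P.load (.inl j)).X × (P.unc (.inl j)).X

/-- State `(xᶜ, xᵘ)` at a bus without inertia. -/
abbrev LoadBusState (j : L) : Type := (P.load (.inr j)).X × (P.unc (.inr j)).X

def genBusField (j : G) (x : P.GenBusState j) (z : ℝ × ℝ) : P.GenBusState j :=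
  ((P.gen j).f x.1 z, (P.load (.inl j)).f x.2.1 z, (P.unc (.inl j)).f x.2.2 z.1)

def genBusOutput (j : G) (x : P.GenBusState j) (z : ℝ × ℝ) : ℝ × ℝ :=
  ((P.gen j).g x.1 z - (P.load (.inl j)).g x.2.1 z, (P.unc (.inl j)).g x.2.2 z.1)

def loadBusField (j : L) (x : P.LoadBusState j) (z : ℝ × ℝ) : P.LoadBusState j :=
  ((P.load (.inr j)).f x.1 z, (P.unc (.inr j)).f x.2 z.1)

def loadBusOutput (j : L) (x : P.LoadBusState j) (z : ℝ × ℝ) : ℝ × ℝ :=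
  (-(P.load (.inr j)).g x.1 z, (P.unc (.inr j)).g x.2 z.1)

/-- The dissipativity condition with positive definite `φ_j` at bus `j`, about the values at `β`. -/
def BusConditionA : G ⊕ L → Prop
  | .inl j => DissipativityA (P.genBusField j) (P.genBusOutput j) (P.ζ β (.inl j))
      (P.xM β j, P.xc β (.inl j), P.xu β (.inl j))
  | .inr j => DissipativityA (P.loadBusField j) (P.loadBusOutput j) (P.ζ β (.inr j))
      (P.xc β (.inr j), P.xu β (.inr j))

/-- The relaxed dissipativity condition at bus `j`, about the values at `β`. -/
def BusConditionB : G ⊕ L → Prop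
  | .inl j => DissipativityB (P.genBusField j) (P.genBusOutput j) (P.ζ β (.inl j))
      (P.xM β j, P.xc β (.inl j), P.xu β (.inl j))
  | .inr j => DissipativityB (P.loadBusField j) (P.loadBusOutput j) (P.ζ β (.inr j))
      (P.xc β (.inr j), P.xu β (.inr j))

/-- At the constant inputs `ζ_j` of `β`, the generation and controllable demand systems have
regions of attraction that can be chosen the same for all nearby constant inputs. -/
def HasCommonRegionsOfAttraction : Prop :=
  (∀ j : G, (P.gen j).HasCommonRegionOfAttraction (P.ζ β (.inl j))) ∧
    ∀ j : G ⊕ L, (P.load j).HasCommonRegionOfAttraction (P.ζ β j)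

end PowerNetwork

/-! ### Optimal supply and load control -/

/-- Cost functions and saturation bounds. -/
structure OSLCData (G L : Type) where
  C : G → ℝ → ℝ
  Cd : G ⊕ L → ℝ → ℝ
  pMmin : G → ℝ
  pMmax : G → ℝ
  pM_le : ∀ j, pMmin j ≤ pMmax j
  dcmin : G ⊕ L → ℝ
  dcmax : G ⊕ L → ℝ
  dc_le : ∀ j, dcmin j ≤ dcmax j

namespace OSLCData

variable {G L : Type} [Fintype G] [Fintype L] (D : OSLCData G L)

/-- Total cost. -/
def cost (q : (G → ℝ) × (G ⊕ L → ℝ)) : ℝ := ∑ j, D.C j (q.1 j) + ∑ j, D.Cd j (q.2 j)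

/-- The pairs `(p^M, dᶜ)` that satisfy power balance and the saturation bounds. -/
def feasible (pL : G ⊕ L → ℝ) : Set ((G → ℝ) × (G ⊕ L → ℝ)) :=
  {q | ∑ j, q.1 j = ∑ j, (q.2 j + pL j) ∧ (∀ j, q.1 j ∈ Icc (D.pMmin j) (D.pMmax j)) ∧
    ∀ j, q.2 j ∈ Icc (D.dcmin j) (D.dcmax j)}

/-- `(p^M, dᶜ)` solves the OSLC problem. -/
def IsOptimal (pL : G ⊕ L → ℝ) (q : (G → ℝ) × (G ⊕ L → ℝ)) : Prop :=
  q ∈ D.feasible pL ∧ IsMinOn D.cost (D.feasible pL) q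

/-- The saturated marginal-cost condition on the static input-output maps. A number `q` with
`C' q = v` is the (unique) value of `(C')⁻¹` at `v`. -/
def SaturatedMarginalCost (P : PowerNetwork G L) : Prop :=
  ∃ f : ℝ × ℝ → ℝ, Function.Surjective f ∧ (∀ a, StrictMono fun p => f (a, p)) ∧
    (∀ (j : G) (z : ℝ × ℝ), ∃ q, deriv (D.C j) q = f z ∧
      (P.gen j).ky z = max (min q (D.pMmax j)) (D.pMmin j)) ∧
    ∀ (j : G ⊕ L) (z : ℝ × ℝ), ∃ q, deriv (D.Cd j) q = -f z ∧
      (P.load j).ky z = max (min q (D.dcmax j)) (D.dcmin j)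

end OSLCData

end

/-! The energy V = ½ΣM(ω−ω*)² + ΣB(−cos η − η sin η*) + ½Σγ(pᶜ−pᶜ*)² + ½Σγₑ(ψ−ψ*)² + ΣV_j, with ω
summed over G only, is a Lyapunov function. Summation by parts on the two graphs turns the network
terms of its derivative into exactly minus the supply rates of the buses without their φ_j
(`energy_balance`), so V' ≤ −Σφ_j(ζ_j−ζ_j*). It has a strict local minimum because |η*| < π/2 and
the V_j have strict minima (`lyapunov_lt`).

Substituting ω^L = f^L removes the algebraic equations and leaves an ordinary differential equation.
Since the outputs g are only continuous, so is its vector field: existence comes from Peano's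
theorem, and LaSalle's principle is proved without uniqueness, by taking limits of all time shifts
of a solution along one ultrafilter (`tendsto_nhdsSet_of_antitoneOn`). A sublevel set of V inside a
small ball traps solutions, which gives global existence, continuation and compactness.

It remains to see that a complete trajectory on which V is constant consists of equilibria
(`isEquilibrium_of_complete`). All φ_j vanish along it, so ω = 0; then η is constant, the
uncontrollable loads rest at equilibrium, and power balance makes every s_j constant. With constant
s the command dynamics are a linear undamped oscillator, so each pᶜ_j is a finite sum of sinusoids
(`exists_sum_sin_of_consensus`). Condition (a) fixes pᶜ_j directly, and (b) forbids nonconstant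
sums. Hence all inputs are constant, and a bounded complete trajectory in a compact part of a region
of attraction can only be the equilibrium itself (`eq_of_mem_regionOfAttraction`).

At any equilibrium, adding up the balances gives Σdᵘ = 0, which forces ω = 0 by the sign condition.
The common value of f(ζ) is then a Lagrange multiplier for the OSLC problem. -/

/-! ### Limits of solutions, LaSalle's principle and Peano's theorem -/

section ODE

variable {E : Type*} [NormedAddCommGroup E] [NormedSpace ℝ E]

theorem IsODESolution.mono {F : E → E} {I J : Set ℝ} {x : ℝ → E} (h : IsODESolution F I x)
    (hJ : J ⊆ I) : IsODESolution F J x :=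
  fun t ht => (h t (hJ ht)).mono hJ

theorem IsODESolution.continuousOn {F : E → E} {I : Set ℝ} {x : ℝ → E}
    (h : IsODESolution F I x) : ContinuousOn x I :=
  fun t ht => (h t ht).continuousWithinAt

theorem IsODESolution.comp_const_add {F : E → E} {I J : Set ℝ} {x : ℝ → E}
    (h : IsODESolution F I x) (c : ℝ) (hJ : MapsTo (fun t => c + t) J I) :
    IsODESolution F J (fun t => x (c + t)) := by
  intro t ht
  have h1 : HasDerivWithinAt (fun t : ℝ => c + t) 1 J t := (hasDerivWithinAt_id t J).const_add c
  have h2 := HasDerivWithinAt.scomp t (h (c + t) (hJ ht)) h1 hJ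
  simpa [Function.comp_def] using h2

theorem IsODESolution.congr {F : E → E} {I : Set ℝ} {x y : ℝ → E}
    (h : IsODESolution F I x) (hxy : EqOn y x I) : IsODESolution F I y := by
  intro t ht
  rw [hxy ht]
  exact (h t ht).congr (fun s hs => hxy hs) (hxy ht)

/-- Increment estimates on intervals around s survive pointwise limits, whereas derivatives need
not. Taking a = s or b = s recovers the one-sided difference quotients. -/
theorem hasDerivWithinAt_of_forall_subinterval {y : ℝ → E} {v : E} {I : Set ℝ} {s : ℝ}
    (hs : s ∈ I)
    (h : ∀ ε > 0, ∃ δ > 0, ∀ a ∈ I, ∀ b ∈ I, a ≤ s → s ≤ b → b - a < δ →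
      ‖y b - y a - (b - a) • v‖ ≤ ε * (b - a)) : HasDerivWithinAt y v I s := by
  rw [hasDerivWithinAt_iff_isLittleO, Asymptotics.isLittleO_iff]
  intro ε hε
  obtain ⟨δ, hδ, h⟩ := h ε hε
  filter_upwards [self_mem_nhdsWithin, mem_nhdsWithin_of_mem_nhds (Metric.ball_mem_nhds s hδ)]
    with t ht htδ
  rw [Metric.mem_ball, Real.dist_eq] at htδ
  rcases le_total s t with hst | hst
  · rw [abs_of_nonneg (by linarith)] at htδ
    rw [Real.norm_of_nonneg (by linarith : 0 ≤ t - s)]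
    exact h s hs t ht le_rfl hst htδ
  · rw [abs_of_nonpos (by linarith)] at htδ
    rw [Real.norm_of_nonpos (by linarith : t - s ≤ 0)]
    have := h t ht s hs hst le_rfl (by linarith)
    rw [← norm_neg, neg_sub]
    calc _ = ‖y s - y t - (s - t) • v‖ := by congr 1; module
      _ ≤ _ := by linarith

/-- This is the mean value inequality for x(t) − t v. -/
theorem norm_sub_sub_smul_le_of_hasDerivWithinAt {x x' : ℝ → E} {a b ε : ℝ} {v : E} (hab : a ≤ b)
    (hx : ∀ t ∈ Icc a b, HasDerivWithinAt x (x' t) (Icc a b) t)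
    (hv : ∀ t ∈ Icc a b, ‖x' t - v‖ ≤ ε) : ‖x b - x a - (b - a) • v‖ ≤ ε * (b - a) := by
  have h1 : ∀ t ∈ Icc a b, HasDerivWithinAt (fun t => x t - t • v) (x' t - v) (Icc a b) t := by
    intro t ht
    simpa using (hx t ht).fun_sub ((hasDerivWithinAt_id t _).smul_const v)
  have := (convex_Icc a b).norm_image_sub_le_of_norm_hasDerivWithin_le h1 hv
    (left_mem_Icc.2 hab) (right_mem_Icc.2 hab)
  rw [Real.norm_of_nonneg (by linarith)] at this
  calc _ = ‖x b - b • v - (x a - a • v)‖ := by congr 1; module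
    _ ≤ _ := this

/-- Pointwise limits of solutions in a compact set are solutions. -/
theorem isODESolution_univ_of_tendsto {F : E → E} {C : Set E} (hC : IsCompact C)
    (hF : ContinuousOn F C) {z : ℝ → E} (hz : IsODESolution F (Ici 0) z)
    (hzC : ∀ t ≥ 0, z t ∈ C) {l : Filter ℝ} [l.NeBot] (hl : l ≤ atTop) {y : ℝ → E}
    (hy : ∀ s, Tendsto (fun t => z (t + s)) l (𝓝 (y s))) : IsODESolution F univ y := by
  intro s _
  obtain ⟨M, hM⟩ := (hC.image_of_continuousOn hF).isBounded.exists_norm_le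
  have hMF : ∀ q ∈ C, ‖F q‖ ≤ M := fun q hq => hM _ (mem_image_of_mem F hq)
  have hev : ∀ a : ℝ, ∀ᶠ t in l, ∀ r ≥ a, 0 ≤ t + r := fun a => by
    filter_upwards [hl (eventually_ge_atTop (-a))] with t ht r hr
    linarith
  have hyC : ∀ s, y s ∈ C := fun s => hC.isClosed.mem_of_tendsto (hy s) <| by
    filter_upwards [hev s] with t ht using hzC _ (ht s le_rfl)
  have hsol : ∀ t a b : ℝ, (∀ r ≥ a, 0 ≤ t + r) → ∀ r ∈ Icc a b,
      HasDerivWithinAt (fun r => z (t + r)) (F (z (t + r))) (Icc a b) r := fun t a b h =>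
    hz.comp_const_add t (J := Icc a b) fun r hr => h r hr.1
  refine hasDerivWithinAt_of_forall_subinterval (mem_univ s) fun ε hε => ?_
  obtain ⟨ρ, hρ, hFρ⟩ := Metric.continuousOn_iff.1 hF (y s) (hyC s) ε hε
  have hM0 : 0 ≤ M := (norm_nonneg _).trans (hMF _ (hyC s))
  -- At speed at most M, a solution moves less than ρ/2 in this time; the other ρ/2 pays for the
  -- distance from z(t + s) to its limit y s. The summand 1 covers M = 0.
  refine ⟨ρ / (2 * (M + 1)), by positivity, fun a _ b _ has hsb hab => ?_⟩
  have hab' : a ≤ b := has.trans hsb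
  have hMab : M * (b - a) < ρ / 2 := by
    rw [lt_div_iff₀ (by positivity)] at hab
    nlinarith
  refine le_of_tendsto ((((hy b).sub (hy a)).sub tendsto_const_nhds).norm) ?_
  filter_upwards [hev a, (hy s).eventually (Metric.ball_mem_nhds (y s) (half_pos hρ))]
    with t hta hts
  refine norm_sub_sub_smul_le_of_hasDerivWithinAt hab' (hsol t a b hta) fun r hr => ?_
  rw [← dist_eq_norm]
  refine (hFρ _ (hzC _ (hta r hr.1)) ?_).le
  have h1 : ‖z (t + r) - z (t + s)‖ ≤ M * ‖r - s‖ :=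
    (convex_Icc a b).norm_image_sub_le_of_norm_hasDerivWithin_le (hsol t a b hta)
      (fun q hq => hMF _ (hzC _ (hta q hq.1))) ⟨has, hsb⟩ hr
  have h2 : ‖r - s‖ ≤ b - a := by
    rw [Real.norm_eq_abs, abs_le]
    constructor <;> linarith [hr.1, hr.2]
  calc dist (z (t + r)) (y s) ≤ dist (z (t + r)) (z (t + s)) + dist (z (t + s)) (y s) :=
        dist_triangle _ _ _
    _ < M * (b - a) + ρ / 2 := by
        refine add_lt_add_of_le_of_lt ?_ hts
        rw [dist_eq_norm]
        exact h1.trans (by gcongr)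
    _ < ρ := by linarith

/-- LaSalle's invariance principle, for a continuous vector field whose solutions need not be
unique. -/
theorem tendsto_nhdsSet_of_antitoneOn {F : E → E} {C : Set E} (hC : IsCompact C)
    (hF : ContinuousOn F C) {z : ℝ → E} (hz : IsODESolution F (Ici 0) z)
    (hzC : ∀ t ≥ 0, z t ∈ C) {V : E → ℝ} (hV : ContinuousOn V C)
    (hanti : AntitoneOn (fun t => V (z t)) (Ici 0)) {K : Set E}
    (hK : ∀ y : ℝ → E, IsODESolution F univ y → (∀ t, y t ∈ C) → (∃ c, ∀ t, V (y t) = c) →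
      y 0 ∈ K) : Tendsto z atTop (𝓝ˢ K) := by
  obtain ⟨c, hc⟩ : ∃ c, Tendsto (fun t => V (z t)) atTop (𝓝 c) := by
    obtain ⟨m, hm⟩ := (hC.image_of_continuousOn hV).bddBelow
    -- Freezing time at 0 makes the function antitone on the whole line, as monotone convergence
    -- requires.
    have h1 : Antitone (fun t : ℝ => V (z (max t 0))) := fun a b hab =>
      hanti (mem_Ici.2 (le_max_right _ _)) (mem_Ici.2 (le_max_right _ _)) (max_le_max_right 0 hab)
    have h2 : BddBelow (range (fun t : ℝ => V (z (max t 0)))) := by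
      refine ⟨m, ?_⟩
      rintro _ ⟨t, rfl⟩
      exact hm (mem_image_of_mem V (hzC _ (le_max_right _ _)))
    refine ⟨_, (tendsto_atTop_ciInf h1 h2).congr' ?_⟩
    filter_upwards [eventually_ge_atTop 0] with t ht
    rw [max_eq_left ht]
  refine tendsto_iff_forall_eventually_mem.2 fun U hU => ?_
  obtain ⟨O, hO, hKO, hOU⟩ := mem_nhdsSet_iff_exists.1 hU
  by_contra hcon
  have hfr : ∃ᶠ t in atTop, z t ∈ C \ O := by
    refine ((not_eventually.1 hcon).and_eventually (eventually_ge_atTop 0)).mono ?_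
    rintro t ⟨h1, h2⟩
    exact ⟨hzC t h2, fun h => h1 (hOU h)⟩
  have : (atTop ⊓ 𝓟 {t | z t ∈ C \ O}).NeBot := frequently_mem_iff_neBot.1 hfr
  -- Along an ultrafilter, compactness yields limits of z(t + s) for all s at once, so no diagonal
  -- subsequence is needed. This one is concentrated on times at which z is outside O, which keeps y
  -- 0 out of O.
  let l : Ultrafilter ℝ := Ultrafilter.of (atTop ⊓ 𝓟 {t | z t ∈ C \ O})
  have hl : (l : Filter ℝ) ≤ atTop := (Ultrafilter.of_le _).trans inf_le_left
  have hlO : ∀ᶠ t in (l : Filter ℝ), z t ∈ C \ O :=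
    ((Ultrafilter.of_le _).trans inf_le_right) (mem_principal_self _)
  have hshift : ∀ s : ℝ, Tendsto (fun t => t + s) l atTop := fun s =>
    tendsto_atTop_add_const_right _ s hl
  have hlim : ∀ s : ℝ, ∃ p ∈ C, Tendsto (fun t => z (t + s)) l (𝓝 p) := by
    intro s
    obtain ⟨p, hp, hp'⟩ := hC.ultrafilter_le_nhds (l.map fun t => z (t + s)) <| by
      rw [le_principal_iff]
      have := (hshift s).eventually (eventually_ge_atTop 0)
      exact this.mono fun t ht => hzC _ ht
    exact ⟨p, hp, hp'⟩
  choose y hyC hy using hlim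
  have hy0 : y 0 ∈ C \ O := by
    refine ⟨hyC 0, fun h => ?_⟩
    have := (hy 0).eventually (hO.mem_nhds h)
    obtain ⟨t, h1, h2⟩ := (this.and hlO).exists
    rw [add_zero] at h1
    exact h2.2 h1
  refine hy0.2 (hKO (hK y (isODESolution_univ_of_tendsto hC hF hz hzC hl hy) hyC ⟨c, fun s => ?_⟩))
  have h1 : Tendsto (fun t => V (z (t + s))) l (𝓝 (V (y s))) := by
    refine (hV (y s) (hyC s)).tendsto.comp (tendsto_nhdsWithin_iff.2 ⟨hy s, ?_⟩)
    have := (hshift s).eventually (eventually_ge_atTop 0)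
    exact this.mono fun t ht => hzC _ ht
  exact tendsto_nhds_unique h1 (hc.comp (hshift s))

/-! ### Peano's theorem -/

/-- The explicit Euler scheme. -/
def eulerScheme (F : E → E) (h : ℝ) (x₀ : E) : ℕ → E
  | 0 => x₀
  | k + 1 => eulerScheme F h x₀ k + h • F (eulerScheme F h x₀ k)

/-- The increment is a sum of b − a terms h F(X_k), each within h ε of h v. The choice v = 0 gives
the speed bound, and v = F(y s) the derivative of the limit. -/
theorem norm_eulerScheme_sub_le {F : E → E} {h : ℝ} (hh : 0 ≤ h) {x₀ v : E} {ε : ℝ} {a b : ℕ}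
    (hab : a ≤ b) (hv : ∀ k, a ≤ k → k < b → ‖F (eulerScheme F h x₀ k) - v‖ ≤ ε) :
    ‖eulerScheme F h x₀ b - eulerScheme F h x₀ a - (((b : ℝ) - a) * h) • v‖
      ≤ ε * (((b : ℝ) - a) * h) := by
  induction b, hab using Nat.le_induction with
  | base => simp
  | succ b hab ih =>
    have h1 := ih fun k h1 h2 => hv k h1 (h2.trans b.lt_succ_self)
    have h2 := hv b hab b.lt_succ_self
    have h3 : ‖h • (F (eulerScheme F h x₀ b) - v)‖ ≤ h * ε := by
      rw [norm_smul, Real.norm_of_nonneg hh]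
      gcongr
    calc _ = ‖(eulerScheme F h x₀ b - eulerScheme F h x₀ a - (((b : ℝ) - a) * h) • v)
          + h • (F (eulerScheme F h x₀ b) - v)‖ := by
          congr 1
          rw [eulerScheme]
          push_cast
          module
      _ ≤ ε * (((b : ℝ) - a) * h) + h * ε := (norm_add_le _ _).trans (add_le_add h1 h3)
      _ = _ := by push_cast; ring

/-- Peano's existence theorem for bounded continuous vector fields. -/
theorem exists_isODESolution_of_continuous [ProperSpace E] {F : E → E} (hF : Continuous F) {M : ℝ}
    (hM : ∀ x, ‖F x‖ ≤ M) (x₀ : E) : ∃ y : ℝ → E, IsODESolution F (Ici 0) y ∧ y 0 = x₀ := by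
  have hM0 : 0 ≤ M := (norm_nonneg _).trans (hM x₀)
  -- Step length 1/n, so that ⌊s n⌋ steps reach time s. For n = 0 the length is 0 by convention,
  -- which the bounds tolerate.
  let h : ℕ → ℝ := fun n => ((n : ℝ))⁻¹
  have hh : ∀ n, 0 ≤ h n := fun n => by positivity
  let N : ℕ → ℝ → ℕ := fun n s => ⌊s * n⌋₊
  have hN : ∀ s : ℝ, 0 ≤ s → Tendsto (fun n => (N n s : ℝ) * h n) atTop (𝓝 s) := fun s hs =>
    ((tendsto_nat_floor_mul_div_atTop hs).comp tendsto_natCast_atTop_atTop).congr fun n => by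
      simp [N, h, div_eq_mul_inv]
  have hNmono : ∀ n, Monotone (N n) := fun n a b hab => by
    simp only [N]
    gcongr
  let X : ℕ → ℕ → E := fun n => eulerScheme F (h n) x₀
  have hXd : ∀ n a b, a ≤ b → ‖X n b - X n a‖ ≤ M * (((b : ℝ) - a) * h n) := fun n a b hab => by
    simpa using norm_eulerScheme_sub_le (F := F) (x₀ := x₀) (v := 0) (hh n) hab
      fun k _ _ => by simpa using hM _
  have hXd' : ∀ n a b k m, a ≤ k → k ≤ b → a ≤ m → m ≤ b →
      ‖X n k - X n m‖ ≤ M * (((b : ℝ) - a) * h n) := by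
    intro n a b k m hak hkb ham hmb
    have c1 : (a : ℝ) ≤ k := by exact_mod_cast hak
    have c2 : (k : ℝ) ≤ b := by exact_mod_cast hkb
    have c3 : (a : ℝ) ≤ m := by exact_mod_cast ham
    have c4 : (m : ℝ) ≤ b := by exact_mod_cast hmb
    rcases le_total k m with hkm | hkm
    · rw [norm_sub_rev]
      refine (hXd n k m hkm).trans ?_
      have := hh n
      gcongr
    · refine (hXd n m k hkm).trans ?_
      have := hh n
      gcongr
  -- The Euler points at time s stay in the ball of radius M s, so an ultrafilter gives their limits
  -- for all s ≥ 0 simultaneously and replaces Arzelà–Ascoli.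
  let l : Ultrafilter ℕ := Ultrafilter.of atTop
  have hl : (l : Filter ℕ) ≤ atTop := Ultrafilter.of_le _
  have hlim : ∀ s : ℝ, ∃ p, 0 ≤ s → Tendsto (fun n => X n (N n s)) l (𝓝 p) := by
    intro s
    by_cases hs : 0 ≤ s
    · obtain ⟨p, -, hp⟩ := (isCompact_closedBall x₀ (M * s)).ultrafilter_le_nhds
        (l.map fun n => X n (N n s)) <| by
          rw [le_principal_iff]
          refine Filter.Eventually.of_forall (f := (l : Filter ℕ))
            (p := fun n => X n (N n s) ∈ Metric.closedBall x₀ (M * s)) fun n => ?_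
          rw [Metric.mem_closedBall, dist_eq_norm]
          refine (hXd n 0 (N n s) (Nat.zero_le _)).trans ?_
          have h1 : (N n s : ℝ) ≤ s * n := Nat.floor_le (by positivity)
          gcongr
          rcases eq_or_ne n 0 with rfl | hn
          · simpa [h] using hs
          · have : (0 : ℝ) < n := by positivity
            simp only [h, Nat.cast_zero, sub_zero]
            rwa [← div_eq_mul_inv, div_le_iff₀ this]
      exact ⟨p, fun _ => hp⟩
    · exact ⟨0, fun h => absurd h hs⟩
  choose y hy using hlim
  refine ⟨y, fun s hs => ?_, ?_⟩
  · refine hasDerivWithinAt_of_forall_subinterval hs fun ε hε => ?_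
    obtain ⟨ρ, hρ, hFρ⟩ := Metric.continuousAt_iff.1 (hF.continuousAt (x := y s)) ε hε
    refine ⟨ρ / (2 * (M + 1)), by positivity, fun a ha b hb has hsb hab => ?_⟩
    have hMab : M * (b - a) < ρ / 2 := by
      rw [lt_div_iff₀ (by positivity)] at hab
      nlinarith
    have hlen : Tendsto (fun n => ((N n b : ℝ) - N n a) * h n) l (𝓝 (b - a)) :=
      (((hN b hb).sub (hN a ha)).congr fun n => by ring).mono_left hl
    refine le_of_tendsto_of_tendsto ((((hy b hb).sub (hy a ha)).sub (hlen.smul_const (F (y s)))).norm)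
      (hlen.const_mul ε) ?_
    filter_upwards [(hlen.const_mul M).eventually (gt_mem_nhds hMab),
      (hy s hs).eventually (Metric.ball_mem_nhds (y s) (half_pos hρ))] with n h1 h2
    refine norm_eulerScheme_sub_le (hh n) (hNmono n (has.trans hsb)) fun k hak hkb => ?_
    rw [← dist_eq_norm]
    refine (hFρ ?_).le
    calc dist (X n k) (y s) ≤ dist (X n k) (X n (N n s)) + dist (X n (N n s)) (y s) :=
        dist_triangle _ _ _
      _ < ρ / 2 + ρ / 2 := by
        refine add_lt_add_of_le_of_lt ?_ h2
        rw [dist_eq_norm]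
        exact (hXd' n _ _ _ _ hak hkb.le (hNmono n has) (hNmono n hsb)).trans h1.le
      _ = ρ := by ring
  · have h0 := hy 0 le_rfl
    have h1 : (fun n => X n (N n 0)) = fun _ => x₀ := by
      funext n
      simp [N, X, eulerScheme]
    rw [h1] at h0
    exact tendsto_nhds_unique h0 tendsto_const_nhds

end ODE

/-! ### Complete trajectories, trapping by a Lyapunov function, and continuation -/

section Lyapunov

variable {E : Type*} [NormedAddCommGroup E] [NormedSpace ℝ E]

/-- A complete trajectory in a compact part of the region of attraction of an asymptotically stable
equilibrium is this equilibrium. -/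
theorem eq_of_mem_regionOfAttraction {F : E → E} (hF : LocallyLipschitz F) {xbar : E}
    (hstab : IsLocallyAsymptoticallyStable F xbar) {x : ℝ → E} (hx : IsODESolution F univ x)
    {C : Set E} (hC : IsCompact C) (hCr : C ⊆ regionOfAttraction F xbar) (hxC : ∀ t, x t ∈ C)
    (t : ℝ) : x t = xbar := by
  -- The trajectory comes arbitrarily close to `xbar` at arbitrarily early times; Lyapunov stability
  -- then confines it at time t. To see this, let p be a cluster point at −∞. The solution from p
  -- tends to `xbar`, and x, when it passes close to p, shadows that solution by Grönwall's
  -- inequality.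
  have hclose : ∀ δ > 0, ∀ T : ℝ, ∃ t ≤ T, dist (x t) xbar < δ := by
    intro δ hδ T
    obtain ⟨p, hpC, hp⟩ := hC.exists_mapClusterPt_of_frequently
      (l := (atBot : Filter ℝ)) (f := x) (Eventually.of_forall hxC).frequently
    obtain ⟨y, hy, hy0, hylim⟩ := hCr hpC
    obtain ⟨T₁, hT₁, hyT₁⟩ : ∃ T₁ : ℝ, 0 ≤ T₁ ∧ dist (y T₁) xbar < δ / 2 :=
      ((eventually_ge_atTop 0).and
        (hylim.eventually (Metric.ball_mem_nhds xbar (half_pos hδ)))).exists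
    have hyc : ContinuousOn y (Icc 0 T₁) := hy.continuousOn.mono Icc_subset_Ici_self
    have hD : IsCompact (C ∪ y '' Icc 0 T₁) := hC.union (isCompact_Icc.image_of_continuousOn hyc)
    obtain ⟨K, hK⟩ := (hF.locallyLipschitzOn (s := C ∪ y '' Icc 0 T₁)).exists_lipschitzOnWith_of_compact hD
    -- A distance below this bound grows to less than δ/2 over a time T₁, by Grönwall with constant
    -- K.
    have hpos : 0 < δ / 2 / Real.exp (K * T₁) := by positivity
    obtain ⟨t₀, ht₀, ht₀T⟩ := ((hp.frequently (Metric.ball_mem_nhds p hpos)).and_eventually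
      (eventually_le_atBot (T - T₁))).exists
    refine ⟨t₀ + T₁, by linarith, ?_⟩
    have hx' : IsODESolution F univ (fun s => x (t₀ + s)) := hx.comp_const_add t₀ (mapsTo_univ _ _)
    have hg := dist_le_of_trajectories_ODE_of_mem (v := fun _ => F)
      (s := fun _ => C ∪ y '' Icc 0 T₁) (K := K) (f := fun s => x (t₀ + s)) (g := y) (a := 0)
      (b := T₁) (fun _ _ => hK) (hx'.continuousOn.mono (subset_univ _))
      (fun s _ => (hx' s (mem_univ _)).mono (subset_univ _)) (fun s _ => Or.inl (hxC _)) hyc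
      (fun s hs => (hy s hs.1).mono fun r hr => hs.1.trans hr)
      (fun s hs => Or.inr (mem_image_of_mem y (Ico_subset_Icc_self hs)))
      (δ := dist (x t₀) p) (by simp [hy0]) T₁ (right_mem_Icc.2 hT₁)
    rw [sub_zero] at hg
    rw [lt_div_iff₀ (Real.exp_pos _)] at ht₀
    calc dist (x (t₀ + T₁)) xbar ≤ dist (x (t₀ + T₁)) (y T₁) + dist (y T₁) xbar :=
          dist_triangle _ _ _
      _ < δ / 2 + δ / 2 := add_lt_add (hg.trans_lt ht₀) hyT₁
      _ = δ := by ring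
  refine dist_le_zero.1 (le_of_forall_pos_le_add fun ε hε => ?_)
  obtain ⟨δ, hδ, h⟩ := hstab.1 ε hε
  obtain ⟨t₀, ht₀, hd⟩ := hclose δ hδ t
  -- Stability is tested on half-open intervals, so one unit is added to include the time t − t₀.
  have := h (t - t₀ + 1) (fun s => x (t₀ + s)) (hx.comp_const_add t₀ (mapsTo_univ _ _))
    (by simpa using hd) (t - t₀) ⟨by linarith, by linarith⟩
  simp only [add_sub_cancel] at this
  linarith

/-- The continuity method. -/
theorem mem_of_forall_Ico_mem {X : Type*} [TopologicalSpace X] {β : ℝ → X} {O : Set X}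
    (hO : IsOpen O) {T : ℝ} (hT : 0 ≤ T) (hβ : ContinuousOn β (Icc 0 T)) (h0 : β 0 ∈ O)
    (hstep : ∀ t ∈ Ioc 0 T, (∀ s ∈ Ico 0 t, β s ∈ O) → β t ∈ O) : β T ∈ O := by
  by_contra hcon
  have hne : (Icc 0 T ∩ β ⁻¹' Oᶜ).Nonempty := ⟨T, right_mem_Icc.2 hT, hcon⟩
  have hcl : IsClosed (Icc 0 T ∩ β ⁻¹' Oᶜ) := hβ.preimage_isClosed_of_isClosed isClosed_Icc hO.isClosed_compl
  -- The set of bad times is closed, so the first exit time is itself bad.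
  have hmem := hcl.csInf_mem hne ⟨0, fun t ht => ht.1.1⟩
  set t := sInf (Icc 0 T ∩ β ⁻¹' Oᶜ) with ht
  refine hmem.2 (hstep t ⟨lt_of_le_of_ne hmem.1.1 ?_, hmem.1.2⟩ fun s hs => ?_)
  · intro h
    exact hmem.2 (h ▸ h0)
  · by_contra hs'
    have hsmem : s ∈ Icc 0 T ∩ β ⁻¹' Oᶜ := ⟨⟨hs.1, hs.2.le.trans hmem.1.2⟩, hs'⟩
    have hle : t ≤ s := csInf_le ⟨0, fun t ht => ht.1.1⟩ hsmem
    exact absurd hs.2 (not_lt.2 hle)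

/-- Composing with the radial retraction onto the ball makes the field globally continuous and
bounded, as needed for `exists_isODESolution_of_continuous`. -/
theorem exists_continuous_bounded_extension [ProperSpace E] {F : E → E} {z : E} {r : ℝ}
    (hr : 0 < r) (hF : ContinuousOn F (Metric.closedBall z r)) :
    ∃ F' : E → E, Continuous F' ∧ (∃ M, ∀ x, ‖F' x‖ ≤ M) ∧
      EqOn F' F (Metric.closedBall z r) := by
  let ρ : E → E := fun x => z + (r / max r ‖x - z‖) • (x - z)
  have hmax : ∀ x : E, 0 < max r ‖x - z‖ := fun x => lt_max_of_lt_left hr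
  have hρc : Continuous ρ := by
    refine continuous_const.add (Continuous.smul (continuous_const.div (by fun_prop)
      fun x => (hmax x).ne') (by fun_prop))
  have hρm : ∀ x, ρ x ∈ Metric.closedBall z r := by
    intro x
    have h1 := hmax x
    rw [mem_closedBall_iff_norm]
    simp only [ρ, add_sub_cancel_left, norm_smul, Real.norm_eq_abs, abs_of_pos (div_pos hr h1)]
    rw [div_mul_eq_mul_div, div_le_iff₀ h1]
    gcongr
    exact le_max_right _ _
  have hρi : ∀ x ∈ Metric.closedBall z r, ρ x = x := by
    intro x hx
    rw [mem_closedBall_iff_norm] at hx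
    simp [ρ, max_eq_left hx, div_self hr.ne']
  obtain ⟨M, hM⟩ := ((isCompact_closedBall z r).image_of_continuousOn hF).isBounded.exists_norm_le
  exact ⟨F ∘ ρ, hF.comp_continuous hρc hρm,
    ⟨M, fun x => hM _ (mem_image_of_mem F (hρm x))⟩, fun x hx => by simp [hρi x hx]⟩

/-- The equation is required only on a set J containing the interior of I; at the remaining points
of I continuity is enough. This matters at a possible exit time, before which alone z is known to
lie in C. -/
theorem antitoneOn_of_fderiv_nonpos {F : E → E} {C : Set E} {V : E → ℝ} (hV : Differentiable ℝ V)
    (hVF : ∀ z ∈ C, fderiv ℝ V z (F z) ≤ 0) {I J : Set ℝ} (hI : Convex ℝ I) (hJ : interior I ⊆ J)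
    {z : ℝ → E} (hz : IsODESolution F J z) (hzc : ContinuousOn z I) (hzC : ∀ t ∈ J, z t ∈ C) :
    AntitoneOn (fun t => V (z t)) I := by
  have hd : ∀ t ∈ interior I, HasDerivAt (fun t => V (z t)) (fderiv ℝ V (z t) (F (z t))) t := by
    intro t ht
    have h1 : HasDerivAt z (F (z t)) t :=
      (hz t (hJ ht)).hasDerivAt (mem_of_superset (isOpen_interior.mem_nhds ht) hJ)
    exact (hV (z t)).hasFDerivAt.comp_hasDerivAt t h1
  refine antitoneOn_of_deriv_nonpos hI (hV.continuous.comp_continuousOn hzc)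
    (fun t ht => (hd t ht).differentiableAt.differentiableWithinAt) fun t ht => ?_
  rw [(hd t ht).deriv]
  exact hVF _ (hzC t (hJ ht))

theorem le_of_fderiv_nonpos {F : E → E} {C : Set E} {V : E → ℝ} (hV : Differentiable ℝ V)
    (hVF : ∀ z ∈ C, fderiv ℝ V z (F z) ≤ 0) {T : ℝ} (hT : 0 ≤ T)
    {z : ℝ → E} (hz : IsODESolution F (Ico 0 T) z) (hzc : ContinuousOn z (Icc 0 T))
    (hzC : ∀ t ∈ Ico 0 T, z t ∈ C) : V (z T) ≤ V (z 0) :=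
  antitoneOn_of_fderiv_nonpos hV hVF (convex_Icc 0 T)
    (by rw [interior_Icc]; exact Ioo_subset_Ico_self) hz hzc hzC (left_mem_Icc.2 hT)
    (right_mem_Icc.2 hT) hT

/-- Solutions that start in a sublevel set of a Lyapunov function inside a ball exist for all
times, and stay there. -/
theorem exists_isODESolution_of_lyapunov [ProperSpace E] {F : E → E} {zs : E} {r : ℝ} (hr : 0 < r)
    (hF : ContinuousOn F (Metric.closedBall zs r)) {V : E → ℝ} (hV : Differentiable ℝ V)
    (hVF : ∀ z ∈ Metric.closedBall zs r, fderiv ℝ V z (F z) ≤ 0) {c : ℝ}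
    (hc : ∀ z ∈ Metric.sphere zs r, c ≤ V z) {z₀ : E} (hz₀ : z₀ ∈ Metric.ball zs r)
    (hVz₀ : V z₀ < c) :
    ∃ z : ℝ → E, IsODESolution F (Ici 0) z ∧ z 0 = z₀ ∧
      ∀ t ≥ 0, z t ∈ Metric.ball zs r ∧ V (z t) ≤ V z₀ := by
  obtain ⟨F', hF'c, ⟨M, hM⟩, hF'⟩ := exists_continuous_bounded_extension hr hF
  obtain ⟨z, hz, hz0⟩ := exists_isODESolution_of_continuous hF'c hM z₀
  -- At a first exit time z would be on the sphere, where V ≥ c, although V has not increased from V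
  -- z₀ < c.
  have hball : ∀ t ≥ 0, z t ∈ Metric.ball zs r := by
    intro T hT
    refine mem_of_forall_Ico_mem Metric.isOpen_ball hT
      (hz.continuousOn.mono Icc_subset_Ici_self) (hz0 ▸ hz₀) fun t ht hs => ?_
    have hzc : ContinuousOn z (Icc 0 t) := hz.continuousOn.mono Icc_subset_Ici_self
    have hle : V (z t) ≤ V (z 0) := by
      refine le_of_fderiv_nonpos (F := F') (C := Metric.closedBall zs r) hV
        (fun p hp => ?_) ht.1.le (hz.mono Ico_subset_Ici_self) hzc
        fun s hs' => Metric.ball_subset_closedBall (hs s hs')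
      rw [hF' hp]
      exact hVF p hp
    have hcl : z t ∈ Metric.closedBall zs r := by
      have h1 : MapsTo z (closure (Ico 0 t)) (closure (Metric.ball zs r)) :=
        MapsTo.closure_of_continuousOn hs (by rwa [closure_Ico ht.1.ne])
      rw [closure_Ico ht.1.ne] at h1
      exact Metric.closure_ball_subset_closedBall (h1 (right_mem_Icc.2 ht.1.le))
    rcases (Metric.mem_closedBall.1 hcl).lt_or_eq with h | h
    · exact h
    · have := hc _ (Metric.mem_sphere.2 h)
      rw [hz0] at hle
      linarith
  have hzF : IsODESolution F (Ici 0) z := fun t ht => by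
    rw [← hF' (Metric.ball_subset_closedBall (hball t ht))]
    exact hz t ht
  refine ⟨z, hzF, hz0, fun t ht => ⟨hball t ht, ?_⟩⟩
  rw [← hz0]
  exact le_of_fderiv_nonpos hV hVF ht (hzF.mono Ico_subset_Ici_self)
    (hzF.continuousOn.mono Icc_subset_Ici_self)
    fun s hs => Metric.ball_subset_closedBall (hball s hs.1)

/-- Concatenation of solutions. -/
theorem exists_isODESolution_extension [FiniteDimensional ℝ E] {F : E → E} {C : Set E}
    (hC : IsCompact C) (hF : ContinuousOn F C) {τ : ℝ} (hτ : 0 < τ) {z : ℝ → E}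
    (hz : IsODESolution F (Ico 0 τ) z) (hzC : ∀ t ∈ Ico 0 τ, z t ∈ C)
    (hext : ∀ p ∈ C, ∃ y : ℝ → E, IsODESolution F (Ici 0) y ∧ y 0 = p ∧ ∀ t ≥ 0, y t ∈ C) :
    ∃ w : ℝ → E, IsODESolution F (Ici 0) w ∧ EqOn w z (Ico 0 τ) ∧ ∀ t ≥ 0, w t ∈ C := by
  obtain ⟨M, hM⟩ := (hC.image_of_continuousOn hF).isBounded.exists_norm_le
  -- F is bounded on C, so z is Lipschitz and has a limit at τ, from which it can be continued.
  have hlip : LipschitzOnWith (Real.toNNReal M) z (Ico 0 τ) :=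
    (convex_Ico 0 τ).lipschitzOnWith_of_nnnorm_hasDerivWithin_le hz fun t ht => by
      rw [← NNReal.coe_le_coe, coe_nnnorm]
      exact (hM _ (mem_image_of_mem F (hzC t ht))).trans (Real.le_coe_toNNReal M)
  obtain ⟨g, hg, hgz⟩ := hlip.extend_finite_dimension
  have hgτ : g τ ∈ C := by
    have h1 : MapsTo g (closure (Ico 0 τ)) C := by
      rw [← hC.isClosed.closure_eq]
      refine MapsTo.closure (fun t ht => ?_) hg.continuous
      rw [← hgz ht]
      exact hzC t ht
    rw [closure_Ico hτ.ne] at h1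
    exact h1 (right_mem_Icc.2 hτ.le)
  obtain ⟨y, hy, hy0, hyC⟩ := hext _ hgτ
  let w : ℝ → E := fun t => if t < τ then g t else y (t - τ)
  have hwl : EqOn w g (Iic τ) := by
    intro t ht
    rcases lt_or_eq_of_le (mem_Iic.1 ht) with h | h
    · simp [w, h]
    · simp [w, h, hy0]
  have hwr : EqOn w (fun t => y (t - τ)) (Ici τ) := fun t ht => by simp [w, not_lt.2 (mem_Ici.1 ht)]
  have hwz : EqOn w z (Ico 0 τ) := fun t ht => by rw [hwl ht.2.le, ← hgz ht]
  have hgsol : IsODESolution F (Ico 0 τ) g := hz.congr fun t ht => (hgz ht).symm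
  have hgd : ∀ t ∈ Ioo 0 τ, HasDerivAt g (F (g t)) t := fun t ht =>
    (hgsol t (Ioo_subset_Ico_self ht)).hasDerivAt (Ico_mem_nhds ht.1 ht.2)
  have hgC : ∀ t ∈ Icc 0 τ, g t ∈ C := by
    intro t ht
    rcases ht.2.lt_or_eq with h | h
    · rw [← hgz ⟨ht.1, h⟩]
      exact hzC t ⟨ht.1, h⟩
    · rwa [h]
  have hIoo : Ioo 0 τ ∈ 𝓝[<] τ := Ioo_mem_nhdsLT hτ
  -- At the junction the left derivative exists because the derivatives F(g t) converge to F(g τ);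
  -- it agrees with the right derivative of the continuation.
  have hgleft : HasDerivWithinAt g (F (g τ)) (Iic τ) τ := by
    refine hasDerivWithinAt_Iic_of_tendsto_deriv (s := Ioo 0 τ)
      (fun t ht => (hgd t ht).differentiableAt.differentiableWithinAt)
      hg.continuous.continuousWithinAt hIoo ?_
    have h1 : Tendsto (fun t => F (g t)) (𝓝[<] τ) (𝓝 (F (g τ))) := by
      refine (hF (g τ) hgτ).tendsto.comp (tendsto_nhdsWithin_iff.2
        ⟨hg.continuous.continuousWithinAt.tendsto, ?_⟩)
      filter_upwards [hIoo] with t ht using hgC t (Ioo_subset_Icc_self ht)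
    refine h1.congr' ?_
    filter_upwards [hIoo] with t ht using (hgd t ht).deriv.symm
  have hysol : IsODESolution F (Ici τ) (fun t => y (t - τ)) := by
    have := hy.comp_const_add (J := Ici τ) (-τ) fun t ht => by
      simpa [add_comm, ← sub_eq_add_neg] using ht
    simpa [add_comm, ← sub_eq_add_neg] using this
  refine ⟨w, fun t ht => ?_, hwz, fun t ht => ?_⟩
  · rcases lt_trichotomy t τ with h | h | h
    · have h1 := hz.congr hwz t ⟨ht, h⟩
      refine h1.mono_of_mem_nhdsWithin ?_
      rw [← Ici_inter_Iio]
      exact inter_mem_nhdsWithin _ (Iio_mem_nhds h)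
    · subst h
      have h2 : HasDerivWithinAt w (F (w t)) (Iic t) t := by
        rw [hwl self_mem_Iic]
        exact hgleft.congr hwl (hwl self_mem_Iic)
      have h3 : HasDerivWithinAt w (F (w t)) (Ici t) t := hysol.congr hwr t self_mem_Ici
      refine (h2.union h3).mono ?_
      rw [Iic_union_Ici]
      exact subset_univ _
    · have h1 := hysol.congr hwr t h.le
      exact (h1.hasDerivAt (Ici_mem_nhds h)).hasDerivWithinAt
  · rcases lt_or_ge t τ with h | h
    · rw [hwz ⟨ht, h⟩]
      exact hzC t ⟨ht, h⟩
    · rw [hwr h]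
      exact hyC _ (by linarith)

/-- Concatenation is applied in the compact set where V ≤ V (z 0) inside the closed ball. The
solution stays there, and since this set misses the sphere, a global solution starts at each of its
points. -/
theorem exists_isODESolution_extension_of_lyapunov [FiniteDimensional ℝ E] {F : E → E} {zs : E}
    {r : ℝ} (hr : 0 < r) (hF : ContinuousOn F (Metric.closedBall zs r)) {V : E → ℝ}
    (hV : Differentiable ℝ V) (hVF : ∀ z ∈ Metric.closedBall zs r, fderiv ℝ V z (F z) ≤ 0) {c : ℝ}
    (hc : ∀ z ∈ Metric.sphere zs r, c ≤ V z) {τ : ℝ} (hτ : 0 < τ) {z : ℝ → E}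
    (hz : IsODESolution F (Ico 0 τ) z) (hzB : ∀ t ∈ Ico 0 τ, z t ∈ Metric.closedBall zs r)
    (hVz : V (z 0) < c) :
    ∃ w : ℝ → E, IsODESolution F (Ici 0) w ∧ EqOn w z (Ico 0 τ) ∧
      ∀ t ≥ 0, w t ∈ Metric.closedBall zs r := by
  have : ProperSpace E := FiniteDimensional.proper ℝ E
  have hC : IsCompact (Metric.closedBall zs r ∩ V ⁻¹' Iic (V (z 0))) :=
    (isCompact_closedBall zs r).inter_right (isClosed_Iic.preimage hV.continuous)
  have hle : ∀ t ∈ Ico 0 τ, V (z t) ≤ V (z 0) := fun t ht =>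
    le_of_fderiv_nonpos hV hVF ht.1 (hz.mono (Ico_subset_Ico_right ht.2.le))
      (hz.continuousOn.mono fun s hs => ⟨hs.1, hs.2.trans_lt ht.2⟩)
      fun s hs => hzB s ⟨hs.1, hs.2.trans ht.2⟩
  have hext : ∀ p ∈ Metric.closedBall zs r ∩ V ⁻¹' Iic (V (z 0)), ∃ y : ℝ → E,
      IsODESolution F (Ici 0) y ∧ y 0 = p ∧
        ∀ t ≥ 0, y t ∈ Metric.closedBall zs r ∩ V ⁻¹' Iic (V (z 0)) := by
    rintro p ⟨hp, hVp⟩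
    have hVp' : V p ≤ V (z 0) := hVp
    have hpb : p ∈ Metric.ball zs r := (Metric.mem_closedBall.1 hp).lt_of_ne fun h =>
      absurd (hc p h) (not_le.2 (hVp'.trans_lt hVz))
    obtain ⟨y, hy, hy0, hyB⟩ :=
      exists_isODESolution_of_lyapunov hr hF hV hVF hc hpb (hVp'.trans_lt hVz)
    exact ⟨y, hy, hy0, fun t ht =>
      ⟨Metric.ball_subset_closedBall (hyB t ht).1, (hyB t ht).2.trans hVp'⟩⟩
  obtain ⟨w, hw, hwz, hwC⟩ := exists_isODESolution_extension hC (hF.mono inter_subset_left) hτ hz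
    (fun t ht => ⟨hzB t ht, hle t ht⟩) hext
  exact ⟨w, hw, hwz, fun t ht => (hwC t ht).1⟩

end Lyapunov

/-! ### Bounded undamped oscillations and graph Laplacians -/

section Sinusoids

theorem eq_zero_of_hasDerivAt_const_of_bounded {f : ℝ → ℝ} {c R : ℝ}
    (hf : ∀ t, HasDerivAt f c t) (hR : ∀ t, |f t| ≤ R) : c = 0 := by
  have hlin : ∀ t, f t = f 0 + c * t := by
    intro t
    have h1 : ∀ t, HasDerivAt (fun t => f t - c * t) 0 t := fun t => by
      simpa using (hf t).fun_sub ((hasDerivAt_id t).const_mul c)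
    have := is_const_of_deriv_eq_zero (fun t => (h1 t).differentiableAt)
      (fun t => (h1 t).deriv) t 0
    simp only [mul_zero, sub_zero] at this
    linarith
  by_contra hc
  -- At this time the affine function equals f 0 + 3R + 1 ≥ 2R + 1, which exceeds R.
  have h1 := hR ((3 * R + 1) / c)
  have h2 := hR 0
  rw [hlin, mul_div_cancel₀ _ hc] at h1
  rw [abs_le] at h1 h2
  linarith [h1.2, h2.1, h2.2]

theorem exists_sin_eq_of_hasDerivAt {y y' : ℝ → ℝ} {l R : ℝ} (hl : 0 ≤ l)
    (hy : ∀ t, HasDerivAt y (y' t) t) (hy' : ∀ t, HasDerivAt y' (-l * y t) t)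
    (hR : ∀ t, |y t| ≤ R) : ∃ A w θ : ℝ, ∀ t, y t = A * Real.sin (w * t + θ) := by
  rcases hl.eq_or_lt with rfl | hl
  · have h1 : ∀ t, y' t = y' 0 := fun t =>
      is_const_of_deriv_eq_zero (fun t => (hy' t).differentiableAt)
        (fun t => by simpa using (hy' t).deriv) t 0
    have h2 : y' 0 = 0 := eq_zero_of_hasDerivAt_const_of_bounded
      (fun t => by rw [← h1 t]; exact hy t) hR
    have h3 : ∀ t, y t = y 0 := fun t =>
      is_const_of_deriv_eq_zero (fun t => (hy t).differentiableAt)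
        (fun t => by rw [(hy t).deriv, h1, h2]) t 0
    exact ⟨y 0, 0, Real.pi / 2, fun t => by simp [h3 t]⟩
  · set w := √l with hw
    have hwpos : 0 < w := Real.sqrt_pos.2 hl
    have hwl : l = w * w := (Real.mul_self_sqrt hl.le).symm
    have hlin : ∀ t, HasDerivAt (fun t => w * t) w t := fun t => by
      simpa using (hasDerivAt_id t).const_mul w
    have hsin := fun t => (hlin t).sin
    have hcos := fun t => (hlin t).cos
    -- Rotating (y, y'/w) back by the angle w t gives two first integrals, this one and the next;
    -- they determine y.
    have hu : ∀ t, y t * Real.cos (w * t) - y' t * Real.sin (w * t) / w = y 0 := by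
      intro t
      have hd : ∀ t, HasDerivAt
          (fun t => y t * Real.cos (w * t) - y' t * Real.sin (w * t) / w) 0 t := by
        intro t
        refine (((hy t).fun_mul (hcos t)).fun_sub (((hy' t).fun_mul (hsin t)).div_const w)).congr_deriv ?_
        rw [hwl]
        field_simp
        ring
      have := is_const_of_deriv_eq_zero (fun t => (hd t).differentiableAt)
        (fun t => (hd t).deriv) t 0
      simpa using this
    have hv : ∀ t, y t * Real.sin (w * t) + y' t * Real.cos (w * t) / w = y' 0 / w := by
      intro t
      have hd : ∀ t, HasDerivAt
          (fun t => y t * Real.sin (w * t) + y' t * Real.cos (w * t) / w) 0 t := by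
        intro t
        refine (((hy t).fun_mul (hsin t)).fun_add (((hy' t).fun_mul (hcos t)).div_const w)).congr_deriv ?_
        rw [hwl]
        field_simp
        ring
      have := is_const_of_deriv_eq_zero (fun t => (hd t).differentiableAt)
        (fun t => (hd t).deriv) t 0
      simpa using this
    -- The polar form of this number supplies amplitude and phase.
    let c : ℂ := ⟨y' 0 / w, y 0⟩
    refine ⟨‖c‖, w, c.arg, fun t => ?_⟩
    have h1 : ‖c‖ * Real.cos c.arg = y' 0 / w := Complex.norm_mul_cos_arg c
    have h2 : ‖c‖ * Real.sin c.arg = y 0 := Complex.norm_mul_sin_arg c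
    have h3 := Real.sin_sq_add_cos_sq (w * t)
    calc y t = y t * (Real.sin (w * t) ^ 2 + Real.cos (w * t) ^ 2) := by rw [h3, mul_one]
      _ = (y t * Real.cos (w * t) - y' t * Real.sin (w * t) / w) * Real.cos (w * t)
          + (y t * Real.sin (w * t) + y' t * Real.cos (w * t) / w) * Real.sin (w * t) := by ring
      _ = ‖c‖ * Real.sin (w * t + c.arg) := by
        rw [hu, hv, Real.sin_add, ← h1, ← h2]
        ring

/-- Bounded solutions of `q'' = -T q`, with `T` positive, are sums of sinusoids. -/
theorem exists_sum_sin_of_isPositive {H : Type*} [NormedAddCommGroup H] [InnerProductSpace ℝ H]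
    [FiniteDimensional ℝ H] {T : H →ₗ[ℝ] H} (hT : T.IsPositive) {q q' : ℝ → H} {R : ℝ}
    (hq : ∀ t, HasDerivAt q (q' t) t) (hq' : ∀ t, HasDerivAt q' (-T (q t)) t)
    (hR : ∀ t, ‖q t‖ ≤ R) (v : H) :
    ∃ (m : ℕ) (A w θ : Fin m → ℝ), ∀ t,
      inner ℝ v (q t) = ∑ k, A k * Real.sin (w k * t + θ k) := by
  -- In an eigenbasis of T the system decouples into scalar oscillators with nonnegative
  -- eigenvalues.
  let b := hT.isSymmetric.eigenvectorBasis (rfl : Module.finrank ℝ H = _)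
  have hb : ∀ k, ∃ A w θ : ℝ, ∀ t, inner ℝ (b k) (q t) = A * Real.sin (w * t + θ) := by
    intro k
    have hev : T (b k) = hT.isSymmetric.eigenvalues rfl k • b k :=
      hT.isSymmetric.apply_eigenvectorBasis rfl k
    refine exists_sin_eq_of_hasDerivAt (l := hT.isSymmetric.eigenvalues rfl k)
      (y' := fun t => inner ℝ (b k) (q' t)) (R := R) (hT.nonneg_eigenvalues rfl k)
      (fun t => ?_) (fun t => ?_) fun t => ?_
    · simpa using (hasDerivAt_const t (b k)).inner ℝ (hq t)
    · refine ((hasDerivAt_const t (b k)).inner ℝ (hq' t)).congr_deriv ?_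
      rw [inner_neg_right, ← hT.isSymmetric, hev, inner_smul_left]
      simp
    · have h1 := abs_real_inner_le_norm (b k) (q t)
      rw [b.orthonormal.1 k, one_mul] at h1
      exact h1.trans (hR t)
  choose A w θ h using hb
  refine ⟨_, fun k => inner ℝ v (b k) * A k, w, θ, fun t => ?_⟩
  rw [← b.sum_inner_mul_inner v (q t)]
  exact Finset.sum_congr rfl fun k _ => by rw [h, mul_assoc]

theorem hasDerivAt_toLp {N : Type*} [Fintype N] {f : ℝ → N → ℝ} {f' : N → ℝ} {t : ℝ}
    (h : ∀ i, HasDerivAt (fun r => f r i) (f' i) t) :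
    HasDerivAt (fun r => WithLp.toLp 2 (f r) : ℝ → EuclideanSpace ℝ N) (WithLp.toLp 2 f') t :=
  (PiLp.hasFDerivAt_toLp (𝕜 := ℝ) 2 (f t)).comp_hasDerivAt t (hasDerivAt_pi.2 h)

namespace OrientedGraph

variable {N : Type*} (Γ : OrientedGraph N)

theorem eq_of_forall_edges {α : Type*} {a : N → α} (h : ∀ e : Γ.edges, a e.1.1 = a e.1.2)
    (i j : N) : a i = a j := by
  obtain ⟨p⟩ := Γ.connected.preconnected i j
  induction p with
  | nil => rfl
  | cons hadj _ ih =>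
    rw [← ih]
    rw [SimpleGraph.fromRel_adj] at hadj
    rcases hadj.2 with h1 | h1
    · exact h ⟨_, h1⟩
    · exact (h ⟨_, h1⟩).symm

variable [DecidableEq N]

theorem netInflow_add (x y : Γ.edges → ℝ) (j : N) :
    Γ.netInflow (fun e => x e + y e) j = Γ.netInflow x j + Γ.netInflow y j := by
  simp only [netInflow, Finset.sum_add_distrib]
  ring

theorem netInflow_sub (x y : Γ.edges → ℝ) (j : N) :
    Γ.netInflow (fun e => x e - y e) j = Γ.netInflow x j - Γ.netInflow y j := by
  simp only [netInflow, Finset.sum_sub_distrib]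
  ring

theorem netInflow_smul (c : ℝ) (x : Γ.edges → ℝ) (j : N) :
    Γ.netInflow (fun e => c * x e) j = c * Γ.netInflow x j := by
  simp only [netInflow, ← Finset.mul_sum]
  ring

theorem hasDerivAt_netInflow {x : ℝ → Γ.edges → ℝ} {x' : Γ.edges → ℝ} {t : ℝ}
    (hx : ∀ e, HasDerivAt (fun r => x r e) (x' e) t) (j : N) :
    HasDerivAt (fun r => Γ.netInflow (x r) j) (Γ.netInflow x' j) t :=
  (HasDerivAt.fun_sum fun e _ => hx e).fun_neg.fun_add (HasDerivAt.fun_sum fun e _ => hx e)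

theorem continuous_netInflow (j : N) : Continuous fun x => Γ.netInflow x j := by
  unfold netInflow
  fun_prop

variable [Fintype N]

/-- Summation by parts: an edge carries −x to its tail and +x to its head. All cancellations in the
network rest on this identity. -/
theorem sum_mul_netInflow (a : N → ℝ) (x : Γ.edges → ℝ) :
    ∑ j, a j * Γ.netInflow x j = -∑ e : Γ.edges, x e * (a e.1.1 - a e.1.2) := by
  have h : ∀ f : Γ.edges → N,
      ∑ j, a j * ∑ e : Γ.edges with f e = j, x e = ∑ e : Γ.edges, x e * a (f e) := by
    intro f
    simp_rw [Finset.mul_sum, Finset.sum_filter]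
    rw [Finset.sum_comm]
    refine Finset.sum_congr rfl fun e _ => ?_
    rw [Finset.sum_ite_eq]
    simp [mul_comm]
  simp only [netInflow, mul_add, mul_neg, Finset.sum_add_distrib, Finset.sum_neg_distrib]
  rw [h (fun e => e.1.1), h (fun e => e.1.2), ← Finset.sum_neg_distrib, ← Finset.sum_neg_distrib,
    ← Finset.sum_add_distrib]
  exact Finset.sum_congr rfl fun e _ => by ring

theorem sum_netInflow (x : Γ.edges → ℝ) : ∑ j, Γ.netInflow x j = 0 := by
  simpa using Γ.sum_mul_netInflow (fun _ => 1) x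

/-- The weighted Laplacian `Γ^{-1/2} D Γₑ⁻¹ Dᵀ Γ^{-1/2}`, with vertex weights `c = Γ^{-1/2}` and edge
weights `w = Γₑ⁻¹`. -/
def weightedLaplacian (c : N → ℝ) (w : Γ.edges → ℝ) :
    EuclideanSpace ℝ N →ₗ[ℝ] EuclideanSpace ℝ N where
  toFun q := WithLp.toLp 2 fun j =>
    -(c j * Γ.netInflow (fun e => w e * (c e.1.1 * q e.1.1 - c e.1.2 * q e.1.2)) j)
  map_add' p q := by
    ext j
    simp only [PiLp.add_apply]
    rw [← neg_add, ← mul_add, ← netInflow_add]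
    congr 3
    funext e
    ring
  map_smul' r q := by
    ext j
    simp only [PiLp.smul_apply, smul_eq_mul, RingHom.id_apply]
    rw [mul_neg, mul_left_comm r, ← Γ.netInflow_smul r]
    congr 3
    funext e
    ring

/-- By summation by parts with vertex function c p, the form is visibly symmetric in p and q, and
nonnegative on the diagonal if w ≥ 0. -/
theorem inner_weightedLaplacian (c : N → ℝ) (w : Γ.edges → ℝ) (p q : EuclideanSpace ℝ N) :
    inner ℝ p (Γ.weightedLaplacian c w q) = ∑ e : Γ.edges,
      w e * (c e.1.1 * q e.1.1 - c e.1.2 * q e.1.2) * (c e.1.1 * p e.1.1 - c e.1.2 * p e.1.2) := by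
  have := Γ.sum_mul_netInflow (fun j => c j * p j)
    (fun e => w e * (c e.1.1 * q e.1.1 - c e.1.2 * q e.1.2))
  rw [← neg_eq_iff_eq_neg, ← Finset.sum_neg_distrib] at this
  rw [← this, PiLp.inner_apply]
  refine Finset.sum_congr rfl fun j _ => ?_
  simp only [weightedLaplacian, LinearMap.coe_mk, AddHom.coe_mk, RCLike.inner_apply, conj_trivial]
  ring

theorem isPositive_weightedLaplacian (c : N → ℝ) {w : Γ.edges → ℝ} (hw : ∀ e, 0 ≤ w e) :
    (Γ.weightedLaplacian c w).IsPositive := by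
  refine ⟨fun p q => ?_, fun p => ?_⟩
  · rw [inner_weightedLaplacian, real_inner_comm, inner_weightedLaplacian]
    exact Finset.sum_congr rfl fun e _ => by ring
  · rw [real_inner_comm, inner_weightedLaplacian]
    simp only [RCLike.re_to_real]
    refine Finset.sum_nonneg fun e _ => ?_
    rw [mul_assoc]
    exact mul_nonneg (hw e) (mul_self_nonneg _)

/-- Bounded trajectories of the power command dynamics with a constant supply are sums of
sinusoids. -/
theorem exists_sum_sin_of_consensus {γ : N → ℝ} (hγ : ∀ j, 0 < γ j) {γe : Γ.edges → ℝ}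
    (hγe : ∀ e, 0 < γe e) {b : N → ℝ} {p : ℝ → N → ℝ} {ψ : ℝ → Γ.edges → ℝ} {R : ℝ}
    (hp : ∀ t j, HasDerivAt (fun r => p r j) ((b j + Γ.netInflow (ψ t) j) / γ j) t)
    (hψ : ∀ t e, HasDerivAt (fun r => ψ r e) ((p t e.1.1 - p t e.1.2) / γe e) t)
    (hR : ∀ t j, |p t j| ≤ R) (j : N) :
    ∃ (m : ℕ) (A w θ : Fin m → ℝ), ∀ t, p t j = ∑ k, A k * Real.sin (w k * t + θ k) := by
  have hsq : ∀ j, 0 < √(γ j) := fun j => Real.sqrt_pos.2 (hγ j)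
  have hss : ∀ j, √(γ j) * √(γ j) = γ j := fun j => Real.mul_self_sqrt (hγ j).le
  -- Differentiating the command equation once more eliminates b and ψ. The scaling q = √γ p then
  -- makes the resulting second-order system symmetric, q'' = −T q.
  let T := Γ.weightedLaplacian (fun j => (√(γ j))⁻¹) (fun e => (γe e)⁻¹)
  have hT : T.IsPositive := Γ.isPositive_weightedLaplacian _ fun e => (inv_pos.2 (hγe e)).le
  let q : ℝ → EuclideanSpace ℝ N := fun t => WithLp.toLp 2 fun j => √(γ j) * p t j
  let q' : ℝ → EuclideanSpace ℝ N := fun t => WithLp.toLp 2 fun j =>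
    (√(γ j))⁻¹ * (b j + Γ.netInflow (ψ t) j)
  have hbd : ∀ t, ‖q t‖ ≤ √(∑ j, γ j * R ^ 2) := by
    intro t
    rw [EuclideanSpace.norm_eq]
    refine Real.sqrt_le_sqrt (Finset.sum_le_sum fun j _ => ?_)
    simp only [q, Real.norm_eq_abs, sq_abs, mul_pow, Real.sq_sqrt (hγ j).le]
    refine mul_le_mul_of_nonneg_left ?_ (hγ j).le
    rw [← sq_abs]
    exact pow_le_pow_left₀ (abs_nonneg _) (hR t j) 2
  have hq : ∀ t, HasDerivAt q (q' t) t := by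
    intro t
    refine hasDerivAt_toLp fun i => ?_
    refine ((hp t i).const_mul (√(γ i))).congr_deriv ?_
    have := (hsq i).ne'
    nth_rw 2 [← hss i]
    field_simp
  have hq' : ∀ t, HasDerivAt q' (-T (q t)) t := by
    intro t
    rw [show -T (q t) = WithLp.toLp 2 (fun i => -(T (q t)) i) from rfl]
    refine hasDerivAt_toLp fun i => ?_
    refine (((Γ.hasDerivAt_netInflow (hψ t) i).const_add (b i)).const_mul
      (√(γ i))⁻¹).congr_deriv ?_
    simp only [T, weightedLaplacian, LinearMap.coe_mk, AddHom.coe_mk, neg_neg, q]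
    congr 2
    funext e
    rw [inv_mul_cancel_left₀ (hsq _).ne', inv_mul_cancel_left₀ (hsq _).ne', div_eq_inv_mul]
  obtain ⟨m, A, w, θ, h⟩ := exists_sum_sin_of_isPositive hT hq hq' hbd
    (EuclideanSpace.single j (√(γ j))⁻¹)
  refine ⟨m, A, w, θ, fun t => ?_⟩
  rw [← h t, EuclideanSpace.inner_single_left]
  simp only [q, conj_trivial]
  rw [← mul_assoc, inv_mul_cancel₀ (hsq j).ne', one_mul]

end OrientedGraph

end Sinusoids

/-! ### Zero frequency and optimality at equilibria -/

section Equilibria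

theorem ConvexOn.deriv_mul_sub_le {f : ℝ → ℝ} (hf : ConvexOn ℝ univ f) (hd : Differentiable ℝ f)
    (x y : ℝ) : deriv f x * (y - x) ≤ f y - f x := by
  rcases lt_trichotomy x y with h | h | h
  · have := hf.deriv_le_slope (mem_univ x) (mem_univ y) h (hd x)
    rw [slope_def_field, le_div_iff₀ (by linarith)] at this
    exact this
  · simp [h]
  · have := hf.slope_le_deriv (mem_univ y) (mem_univ x) h (hd x)
    rw [slope_def_field, div_le_iff₀ (by linarith)] at this
    linarith

/-- First-order optimality of the saturation `x` of a point `q` with marginal cost `v`. -/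
theorem mul_sub_le_of_deriv_eq_of_clamp {f : ℝ → ℝ} (hf : ConvexOn ℝ univ f)
    (hd : Differentiable ℝ f) {a b q v x y : ℝ} (hab : a ≤ b) (hq : deriv f q = v)
    (hx : x = max (min q b) a) (hy : y ∈ Icc a b) : v * (y - x) ≤ f y - f x := by
  -- The tangent inequality leaves the comparison of v with f'(x). They can differ only when x is
  -- saturated, and then monotonicity of f' gives a difference of the right sign for y − x.
  refine le_trans ?_ (hf.deriv_mul_sub_le hd x y)
  have hmono : Monotone (deriv f) := fun s t hst =>
    hf.monotoneOn_deriv (fun x _ => hd x) (mem_univ s) (mem_univ t) hst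
  rw [← hq, hx]
  rcases le_total q a with h | h
  · rw [min_eq_left (h.trans hab), max_eq_right h]
    exact mul_le_mul_of_nonneg_right (hmono h) (by linarith [hy.1])
  · rcases le_total q b with h' | h'
    · rw [min_eq_left h', max_eq_left h]
    · rw [min_eq_right h', max_eq_left hab]
      exact mul_le_mul_of_nonpos_right (hmono h') (by linarith [hy.2])

namespace PowerNetwork

variable {G L : Type} {P : PowerNetwork G L} {β : P.State}

theorem sum_s [Fintype G] [Fintype L] (β : P.State) : ∑ j, P.s β j = ∑ j, P.pM β j - ∑ j, P.dc β j := by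
  simp only [Fintype.sum_sum_type, s, Finset.sum_sub_distrib, Finset.sum_neg_distrib]
  ring

variable [DecidableEq G] [DecidableEq L]

theorem IsEquilibrium.pc_eq_pc (h : P.IsEquilibrium β) (i j : G ⊕ L) : P.pc β i = P.pc β j :=
  P.comm.eq_of_forall_edges (fun e => sub_eq_zero.1 (h.ψ_eq e)) i j

theorem IsEquilibrium.balance_eq (h : P.IsEquilibrium β) (j : G ⊕ L) : P.balance β j = 0 := by
  cases j with
  | inl j => exact h.ω_eq j
  | inr j => exact h.algebraic j

variable [Fintype G] [Fintype L]

theorem IsEquilibrium.sum_s_eq (h : P.IsEquilibrium β) : ∑ j, P.s β j = ∑ j, P.pL j := by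
  have h1 : ∑ j, P.commandBalance β j = 0 := Finset.sum_eq_zero fun j _ => h.pc_eq j
  simp only [commandBalance, Finset.sum_add_distrib, P.comm.sum_netInflow, Finset.sum_neg_distrib,
    Finset.sum_sub_distrib] at h1
  linarith

/-- The frequency is the same at all buses, and adding up the power balances and the command
equations gives Σdᵘ = 0. By the sign condition a nonzero common frequency would make every product ω
dᵘ_j positive. -/
theorem IsEquilibrium.ω_eq_zero (hdu : ∀ j, ∀ u : ℝ, u ≠ 0 → 0 < u * (P.unc j).ky u)
    (h : P.IsEquilibrium β) : P.ω β = 0 := by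
  have hω : ∀ i j, P.ω β i = P.ω β j :=
    P.line.eq_of_forall_edges (fun e => sub_eq_zero.1 (h.η_eq e))
  have h1 : ∑ j, P.balance β j = 0 := Finset.sum_eq_zero fun j _ => h.balance_eq j
  simp only [balance, Finset.sum_add_distrib, P.line.sum_netInflow, Finset.sum_neg_distrib,
    Finset.sum_sub_distrib, h.sum_s_eq] at h1
  have hsum : ∑ j, P.du β j = 0 := by linarith
  have hdu' : ∀ j, P.du β j = -(P.unc j).ky (-P.ω β j) := fun j => by
    rw [du, (P.unc j).equilibrium_iff _ _ |>.1 (h.xu_eq j), DynSys.ky]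
  funext i
  by_contra hi
  have hpos : 0 < ∑ j, P.ω β i * P.du β j := by
    refine Finset.sum_pos (fun j _ => ?_) ⟨i, Finset.mem_univ i⟩
    have := hdu j (-P.ω β j) (neg_ne_zero.2 (by rw [hω j i]; exact hi))
    rw [hω i j, hdu' j]
    linarith
  rw [← Finset.mul_sum, hsum, mul_zero] at hpos
  exact lt_irrefl _ hpos

/-- All buses see the same input, so v = f(ζ) is a common Lagrange multiplier. Each bus satisfies
its own first-order inequality with price v; in the sum the price terms cancel, as both allocations
satisfy power balance. -/
theorem IsEquilibrium.isOptimal {D : OSLCData G L}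
    (hC : ∀ j, ContDiff ℝ 1 (D.C j) ∧ StrictConvexOn ℝ Set.univ (D.C j))
    (hCd : ∀ j, ContDiff ℝ 1 (D.Cd j) ∧ StrictConvexOn ℝ Set.univ (D.Cd j))
    (hcont : D.SaturatedMarginalCost P) (hω : P.ω β = 0) (h : P.IsEquilibrium β) :
    D.IsOptimal P.pL (P.pM β, P.dc β) := by
  obtain ⟨f, -, -, hM, hd⟩ := hcont
  obtain ⟨i₀⟩ : Nonempty (G ⊕ L) := P.comm.connected.nonempty
  have hζ : ∀ j, P.ζ β j = P.ζ β i₀ := fun j => by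
    simp only [ζ, hω, Pi.zero_apply, h.pc_eq_pc j i₀]
  set v := f (P.ζ β i₀) with hv
  have hpM : ∀ j, ∃ q, deriv (D.C j) q = v ∧ P.pM β j = max (min q (D.pMmax j)) (D.pMmin j) := by
    intro j
    obtain ⟨q, hq, hk⟩ := hM j (P.ζ β (.inl j))
    refine ⟨q, by rw [hq, hζ], ?_⟩
    rw [← hk, pM, (P.gen j).equilibrium_iff _ _ |>.1 (h.xM_eq j), DynSys.ky]
  have hdc : ∀ j, ∃ q, deriv (D.Cd j) q = -v ∧ P.dc β j = max (min q (D.dcmax j)) (D.dcmin j) := by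
    intro j
    obtain ⟨q, hq, hk⟩ := hd j (P.ζ β j)
    refine ⟨q, by rw [hq, hζ], ?_⟩
    rw [← hk, dc, (P.load j).equilibrium_iff _ _ |>.1 (h.xc_eq j), DynSys.ky]
  have hbal : ∑ j, P.pM β j = ∑ j, (P.dc β j + P.pL j) := by
    have h1 := h.sum_s_eq
    rw [sum_s] at h1
    rw [Finset.sum_add_distrib]
    linarith
  refine ⟨⟨hbal, fun j => ?_, fun j => ?_⟩, fun q hq => ?_⟩
  · obtain ⟨q, -, hk⟩ := hpM j
    change P.pM β j ∈ _
    rw [hk]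
    exact ⟨le_max_right _ _, max_le (min_le_right _ _) (D.pM_le j)⟩
  · obtain ⟨q, -, hk⟩ := hdc j
    change P.dc β j ∈ _
    rw [hk]
    exact ⟨le_max_right _ _, max_le (min_le_right _ _) (D.dc_le j)⟩
  · obtain ⟨hqb, hqM, hqd⟩ := hq
    have h1 : ∀ j, v * (q.1 j - P.pM β j) ≤ D.C j (q.1 j) - D.C j (P.pM β j) := fun j => by
      obtain ⟨p, hp, hk⟩ := hpM j
      exact mul_sub_le_of_deriv_eq_of_clamp (hC j).2.convexOn
        ((hC j).1.differentiable one_ne_zero) (D.pM_le j) hp hk (hqM j)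
    have h2 : ∀ j, -v * (q.2 j - P.dc β j) ≤ D.Cd j (q.2 j) - D.Cd j (P.dc β j) := fun j => by
      obtain ⟨p, hp, hk⟩ := hdc j
      exact mul_sub_le_of_deriv_eq_of_clamp (hCd j).2.convexOn
        ((hCd j).1.differentiable one_ne_zero) (D.dc_le j) hp hk (hqd j)
    have h3 := Finset.sum_le_sum fun j (_ : j ∈ Finset.univ) => h1 j
    have h4 := Finset.sum_le_sum fun j (_ : j ∈ Finset.univ) => h2 j
    rw [Finset.sum_add_distrib] at hqb hbal
    rw [← Finset.mul_sum, Finset.sum_sub_distrib, Finset.sum_sub_distrib] at h3 h4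
    change D.cost (P.pM β, P.dc β) ≤ D.cost q
    simp only [OSLCData.cost]
    have h5 : v * (∑ j, q.1 j - ∑ j, P.pM β j) = v * (∑ j, q.2 j - ∑ j, P.dc β j) := by
      rw [hqb, hbal]
      ring
    linarith

end PowerNetwork

end Equilibria

/-! ### Separating the differential variables from the algebraic ones -/

section DifferentialState

theorem HasDerivWithinAt.prodFst {A B : Type*} [NormedAddCommGroup A] [NormedSpace ℝ A]
    [NormedAddCommGroup B] [NormedSpace ℝ B] {f : ℝ → A × B} {f' : A × B} {I : Set ℝ} {t : ℝ}
    (h : HasDerivWithinAt f f' I t) : HasDerivWithinAt (fun r => (f r).1) f'.1 I t :=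
  (ContinuousLinearMap.fst ℝ A B).hasFDerivAt.comp_hasDerivWithinAt t h

theorem HasDerivWithinAt.prodSnd {A B : Type*} [NormedAddCommGroup A] [NormedSpace ℝ A]
    [NormedAddCommGroup B] [NormedSpace ℝ B] {f : ℝ → A × B} {f' : A × B} {I : Set ℝ} {t : ℝ}
    (h : HasDerivWithinAt f f' I t) : HasDerivWithinAt (fun r => (f r).2) f'.2 I t :=
  (ContinuousLinearMap.snd ℝ A B).hasFDerivAt.comp_hasDerivWithinAt t h

theorem DynSys.continuous_f {U : Type} [NormedAddCommGroup U] (S : DynSys U) :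
    Continuous fun p : S.X × U => S.f p.1 p.2 :=
  S.f_lipschitz.continuous

theorem DynSys.locallyLipschitz_f {U : Type} [NormedAddCommGroup U] (S : DynSys U) (u : U) :
    LocallyLipschitz fun x => S.f x u :=
  S.f_lipschitz.comp (LocallyLipschitz.prodMk_right u)

namespace PowerNetwork

variable {G L : Type} (P : PowerNetwork G L)

/-- The variables `(η, ψ, ω^G, x^M, xᶜ, xᵘ, pᶜ)` governed by differential equations. -/
abbrev DiffState : Type :=
  (P.line.edges → ℝ) × (P.comm.edges → ℝ) × (G → ℝ) × ((j : G) → (P.gen j).X) ×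
    ((j : G ⊕ L) → (P.load j).X) × ((j : G ⊕ L) → (P.unc j).X) × (G ⊕ L → ℝ)

/-- The components of a state that are governed by differential equations. -/
def diffPart (β : P.State) : P.DiffState :=
  (P.η β, P.ψ β, fun j => P.ω β (.inl j), P.xM β, P.xc β, P.xu β, P.pc β)

/-- The state with given differential components and given frequencies at the buses in `L`. -/
def combine (z : P.DiffState) (w : L → ℝ) : P.State :=
  (z.1, z.2.1, Sum.elim z.2.2.1 w, z.2.2.2)

/-- The components `(η, ω^G, xᶜ, xᵘ, pᶜ)` of a differential state. -/
def reducedDiff (z : P.DiffState) : P.ReducedState :=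
  (z.1, z.2.2.1, z.2.2.2.2.1, z.2.2.2.2.2.1, z.2.2.2.2.2.2)

theorem combine_diffPart (β : P.State) : P.combine (P.diffPart β) (P.ωL β) = β := by
  obtain ⟨η, ψ, ω, x⟩ := β
  simp only [combine, diffPart]
  congr 3
  funext j
  cases j <;> rfl

theorem continuous_diffPart : Continuous P.diffPart := by
  unfold diffPart
  fun_prop

theorem continuous_ωL : Continuous P.ωL := by
  unfold ωL
  fun_prop

theorem continuous_reducedDiff : Continuous P.reducedDiff := by
  unfold reducedDiff
  fun_prop

theorem continuous_combine : Continuous fun p : P.DiffState × (L → ℝ) => P.combine p.1 p.2 := by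
  unfold combine
  refine (by fun_prop : Continuous fun p : P.DiffState × (L → ℝ) => p.1.1).prodMk
    ((by fun_prop : Continuous fun p : P.DiffState × (L → ℝ) => p.1.2.1).prodMk
    (Continuous.prodMk (continuous_pi fun j => ?_) (by fun_prop)))
  cases j <;> simp only [Sum.elim_inl, Sum.elim_inr] <;> fun_prop

theorem continuous_ζ (j : G ⊕ L) : Continuous fun β : P.State => P.ζ β j := by
  unfold ζ
  fun_prop

theorem continuous_pM (j : G) : Continuous fun β : P.State => P.pM β j :=
  (P.gen j).g_continuous.comp
    ((by fun_prop : Continuous fun β : P.State => P.xM β j).prodMk (P.continuous_ζ _))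

theorem continuous_dc (j : G ⊕ L) : Continuous fun β : P.State => P.dc β j :=
  (P.load j).g_continuous.comp
    ((by fun_prop : Continuous fun β : P.State => P.xc β j).prodMk (P.continuous_ζ _))

theorem continuous_du (j : G ⊕ L) : Continuous fun β : P.State => P.du β j :=
  ((P.unc j).g_continuous.comp
    ((by fun_prop : Continuous fun β : P.State => P.xu β j).prodMk
      (by fun_prop : Continuous fun β : P.State => -P.ω β j))).neg

theorem continuous_s : (j : G ⊕ L) → Continuous fun β : P.State => P.s β j
  | .inl j => (P.continuous_pM j).sub (P.continuous_dc (.inl j))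
  | .inr j => (P.continuous_dc (.inr j)).neg

theorem continuous_flow (e : P.line.edges) : Continuous fun β : P.State => P.flow β e := by
  unfold flow
  fun_prop

variable [DecidableEq G] [DecidableEq L]

theorem continuous_balance (j : G ⊕ L) : Continuous fun β : P.State => P.balance β j :=
  ((continuous_const.add (P.continuous_s j)).sub (P.continuous_du j)).add
    ((P.line.continuous_netInflow j).comp (continuous_pi P.continuous_flow))

theorem continuous_commandBalance (j : G ⊕ L) :
    Continuous fun β : P.State => P.commandBalance β j :=
  ((P.continuous_s j).sub continuous_const).neg.add
    ((P.comm.continuous_netInflow j).comp (by fun_prop : Continuous fun β : P.State => P.ψ β))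

/-- The right-hand side of the differential equations. -/
noncomputable def field (β : P.State) : P.DiffState :=
  (fun e => P.ω β e.1.1 - P.ω β e.1.2, fun e => (P.pc β e.1.1 - P.pc β e.1.2) / P.γe e,
    fun j => P.balance β (.inl j) / P.M j, fun j => (P.gen j).f (P.xM β j) (P.ζ β (.inl j)),
    fun j => (P.load j).f (P.xc β j) (P.ζ β j), fun j => (P.unc j).f (P.xu β j) (-P.ω β j),
    fun j => P.commandBalance β j / P.γ j)

theorem continuous_field : Continuous P.field := by
  refine Continuous.prodMk (by fun_prop) (Continuous.prodMk (by fun_prop) (Continuous.prodMk ?_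
    (Continuous.prodMk ?_ (Continuous.prodMk ?_ (Continuous.prodMk ?_ ?_)))))
  · exact continuous_pi fun j => (P.continuous_balance _).div_const _
  · exact continuous_pi fun j => (P.gen j).continuous_f.comp
      ((by fun_prop : Continuous fun β : P.State => P.xM β j).prodMk (P.continuous_ζ _))
  · exact continuous_pi fun j => (P.load j).continuous_f.comp
      ((by fun_prop : Continuous fun β : P.State => P.xc β j).prodMk (P.continuous_ζ _))
  · exact continuous_pi fun j => (P.unc j).continuous_f.comp
      ((by fun_prop : Continuous fun β : P.State => P.xu β j).prodMk
        (by fun_prop : Continuous fun β : P.State => -P.ω β j))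
  · exact continuous_pi fun j => (P.continuous_commandBalance _).div_const _

variable {P}

theorem isEquilibrium_iff {β : P.State} :
    P.IsEquilibrium β ↔ P.field β = 0 ∧ P.AlgebraicEquations β := by
  have hM : ∀ j, P.M j ≠ 0 := fun j => (P.M_pos j).ne'
  have hγ : ∀ j, P.γ j ≠ 0 := fun j => (P.γ_pos j).ne'
  have hγe : ∀ j, P.γe j ≠ 0 := fun j => (P.γe_pos j).ne'
  constructor
  · intro h
    refine ⟨?_, h.algebraic⟩
    simp only [field, Prod.ext_iff, Prod.fst_zero, Prod.snd_zero, funext_iff, Pi.zero_apply,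
      div_eq_zero_iff, hM, hγ, hγe, or_false]
    exact ⟨h.η_eq, h.ψ_eq, h.ω_eq, fun j i => congr_fun (h.xM_eq j) i,
      fun j i => congr_fun (h.xc_eq j) i, fun j i => congr_fun (h.xu_eq j) i, h.pc_eq⟩
  · rintro ⟨h, ha⟩
    simp only [field, Prod.ext_iff, Prod.fst_zero, Prod.snd_zero, funext_iff, Pi.zero_apply,
      div_eq_zero_iff, hM, hγ, hγe, or_false] at h
    obtain ⟨h1, h2, h3, h4, h5, h6, h7⟩ := h
    exact ⟨h1, h3, ha, fun j => funext (h4 j), fun j => funext (h5 j), fun j => funext (h6 j),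
      h2, h7⟩

variable [Fintype G] [Fintype L]

theorem IsSolution.hasDerivWithinAt_diffPart {I : Set ℝ} {β : ℝ → P.State}
    (h : P.IsSolution I β) {t : ℝ} (ht : t ∈ I) :
    HasDerivWithinAt (fun r => P.diffPart (β r)) (P.field (β t)) I t := by
  refine (hasDerivWithinAt_pi.2 (h.η_deriv t ht)).prodMk
    ((hasDerivWithinAt_pi.2 (h.ψ_deriv t ht)).prodMk
    ((hasDerivWithinAt_pi.2 (h.ω_deriv t ht)).prodMk
    ((hasDerivWithinAt_pi.2 (h.xM_deriv t ht)).prodMk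
    ((hasDerivWithinAt_pi.2 (h.xc_deriv t ht)).prodMk
    ((hasDerivWithinAt_pi.2 (h.xu_deriv t ht)).prodMk
    (hasDerivWithinAt_pi.2 (h.pc_deriv t ht)))))))

theorem isSolution_of_hasDerivWithinAt {I : Set ℝ} {β : ℝ → P.State}
    (h : ∀ t ∈ I, HasDerivWithinAt (fun r => P.diffPart (β r)) (P.field (β t)) I t)
    (hc : ContinuousOn β I) (ha : ∀ t ∈ I, P.AlgebraicEquations (β t)) : P.IsSolution I β where
  η_deriv t ht e := hasDerivWithinAt_pi.1 (h t ht).prodFst e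
  ψ_deriv t ht e := hasDerivWithinAt_pi.1 (h t ht).prodSnd.prodFst e
  ω_deriv t ht j := hasDerivWithinAt_pi.1 (h t ht).prodSnd.prodSnd.prodFst j
  ω_cont j := (by fun_prop : Continuous fun β : P.State => P.ω β (.inr j)).comp_continuousOn hc
  algebraic := ha
  xM_deriv t ht j := hasDerivWithinAt_pi.1 (h t ht).prodSnd.prodSnd.prodSnd.prodFst j
  xc_deriv t ht j := hasDerivWithinAt_pi.1 (h t ht).prodSnd.prodSnd.prodSnd.prodSnd.prodFst j
  xu_deriv t ht j :=
    hasDerivWithinAt_pi.1 (h t ht).prodSnd.prodSnd.prodSnd.prodSnd.prodSnd.prodFst j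
  pc_deriv t ht j :=
    hasDerivWithinAt_pi.1 (h t ht).prodSnd.prodSnd.prodSnd.prodSnd.prodSnd.prodSnd j

theorem IsSolution.continuousOn {I : Set ℝ} {β : ℝ → P.State} (h : P.IsSolution I β) :
    ContinuousOn β I := by
  have h1 : ContinuousOn (fun r => P.combine (P.diffPart (β r)) (P.ωL (β r))) I := by
    refine P.continuous_combine.comp_continuousOn (ContinuousOn.prodMk (fun t ht => ?_) ?_)
    · exact (h.hasDerivWithinAt_diffPart ht).continuousWithinAt
    · exact continuousOn_pi.2 h.ω_cont
  simpa only [combine_diffPart] using h1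

end PowerNetwork

end DifferentialState

/-! ### Potential energy of a line and storage functions of the buses -/

section Storage

theorem hasFDerivAt_sum_comp {ι E : Type*} [Fintype ι] [NormedAddCommGroup E] [NormedSpace ℝ E]
    {F F' : ι → ℝ → ℝ} (hF : ∀ i x, HasDerivAt (F i) (F' i x) x) (l : ι → E →L[ℝ] ℝ) (z : E) :
    HasFDerivAt (fun z => ∑ i, F i (l i z)) (∑ i, F' i (l i z) • l i) z :=
  HasFDerivAt.fun_sum fun i _ => (hF i _).comp_hasFDerivAt z (l i).hasFDerivAt

/-- `-cos - a sin a*` has a strict minimum at `a*` on `(-π/2, π/2)`. -/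
theorem neg_cos_sub_lt {a x : ℝ} (ha : |a| < Real.pi / 2) (hx : |x| < Real.pi / 2) (hne : x ≠ a) :
    -Real.cos a - Real.sin a * a < -Real.cos x - Real.sin a * x := by
  rw [abs_lt] at ha hx
  -- The derivative sin y − sin a has the sign of y − a on (−π/2, π/2).
  have hd : ∀ y, HasDerivAt (fun y => -Real.cos y - Real.sin a * y) (Real.sin y - Real.sin a) y := by
    intro y
    simpa using (Real.hasDerivAt_cos y).fun_neg.fun_sub
      ((hasDerivAt_id y).const_mul (Real.sin a))
  have hc : Continuous fun y => -Real.cos y - Real.sin a * y := by fun_prop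
  rcases lt_or_gt_of_ne hne with h | h
  · refine strictAntiOn_of_deriv_neg (convex_Icc x a) hc.continuousOn (fun y hy => ?_)
      (left_mem_Icc.2 h.le) (right_mem_Icc.2 h.le) h
    rw [interior_Icc] at hy
    rw [(hd y).deriv, sub_neg]
    exact Real.strictMonoOn_sin ⟨by linarith [hy.1], by linarith [hy.2]⟩
      ⟨by linarith, by linarith⟩ hy.2
  · refine strictMonoOn_of_deriv_pos (convex_Icc a x) hc.continuousOn (fun y hy => ?_)
      (left_mem_Icc.2 h.le) (right_mem_Icc.2 h.le) h
    rw [interior_Icc] at hy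
    rw [(hd y).deriv, sub_pos]
    exact Real.strictMonoOn_sin ⟨by linarith, by linarith⟩
      ⟨by linarith [hy.1], by linarith [hy.2]⟩ hy.1

namespace PowerNetwork

variable {G L : Type} [Fintype G] [Fintype L] [DecidableEq G] [DecidableEq L]
  {P : PowerNetwork G L}

/-- `U` is a storage function at bus `j`, about the values at `βs`, with dissipation rate `φ`. -/
structure IsBusStorage (βs : P.State) (j : G ⊕ L) (U : P.DiffState → ℝ) (φ : ℝ × ℝ → ℝ) :
    Prop where
  differentiable : Differentiable ℝ U
  isLocalMin : ∀ᶠ z in 𝓝 (P.diffPart βs), U (P.diffPart βs) ≤ U z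
  eq_of_eq : ∀ᶠ z in 𝓝 (P.diffPart βs), U z = U (P.diffPart βs) →
    (∀ i, j = .inl i → z.2.2.2.1 i = P.xM βs i) ∧ z.2.2.2.2.1 j = P.xc βs j ∧
      z.2.2.2.2.2.1 j = P.xu βs j
  fderiv_le : ∀ᶠ β in 𝓝 βs, fderiv ℝ U (P.diffPart β) (P.field β) ≤
    supplyRate φ (P.ζ βs j) (P.s βs j, -P.du βs j) (P.ζ β j) (P.s β j, -P.du β j)

/-- Near `βs`, complete trajectories with constant frequency and net supply at bus `j` do not have
a nontrivial sinusoid as their power command. -/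
def ExcludesSinusoidsAt (βs : P.State) (j : G ⊕ L) : Prop :=
  ∃ O ∈ 𝓝 βs, ∀ β : ℝ → P.State, P.IsSolution univ β → (∀ t, β t ∈ O) →
    (∃ w, ∀ t, P.ω (β t) j = w) → (∃ c, ∀ t, P.s (β t) j = c) →
    ¬ IsNontrivialSinusoid fun t => P.pc (β t) j

/-- The state `(x^M, xᶜ, xᵘ)` of bus `j ∈ G`. -/
def genBusProj (P : PowerNetwork G L) (j : G) : P.DiffState →L[ℝ] P.GenBusState j :=
  let tail := (ContinuousLinearMap.snd ℝ (G → ℝ) _).comp ((ContinuousLinearMap.snd ℝ _ _).comp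
    (ContinuousLinearMap.snd ℝ (P.line.edges → ℝ) ((P.comm.edges → ℝ) × (G → ℝ) ×
      ((j : G) → (P.gen j).X) × ((j : G ⊕ L) → (P.load j).X) × ((j : G ⊕ L) → (P.unc j).X) ×
      (G ⊕ L → ℝ))))
  let tail' := (ContinuousLinearMap.snd ℝ ((j : G) → (P.gen j).X) _).comp tail
  ((ContinuousLinearMap.proj j).comp ((ContinuousLinearMap.fst ℝ _ _).comp tail)).prod
    (((ContinuousLinearMap.proj (Sum.inl j)).comp ((ContinuousLinearMap.fst ℝ _ _).comp tail')).prod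
      ((ContinuousLinearMap.proj (Sum.inl j)).comp ((ContinuousLinearMap.fst ℝ _ _).comp
        ((ContinuousLinearMap.snd ℝ _ _).comp tail'))))

/-- The state `(xᶜ, xᵘ)` of bus `j ∈ L`. -/
def loadBusProj (P : PowerNetwork G L) (j : L) : P.DiffState →L[ℝ] P.LoadBusState j :=
  let tail := (ContinuousLinearMap.snd ℝ (G → ℝ) _).comp ((ContinuousLinearMap.snd ℝ _ _).comp
    (ContinuousLinearMap.snd ℝ (P.line.edges → ℝ) ((P.comm.edges → ℝ) × (G → ℝ) ×
      ((j : G) → (P.gen j).X) × ((j : G ⊕ L) → (P.load j).X) × ((j : G ⊕ L) → (P.unc j).X) ×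
      (G ⊕ L → ℝ))))
  let tail' := (ContinuousLinearMap.snd ℝ ((j : G) → (P.gen j).X) _).comp tail
  ((ContinuousLinearMap.proj (Sum.inr j)).comp ((ContinuousLinearMap.fst ℝ _ _).comp tail')).prod
    ((ContinuousLinearMap.proj (Sum.inr j)).comp ((ContinuousLinearMap.fst ℝ _ _).comp
      ((ContinuousLinearMap.snd ℝ _ _).comp tail')))

section

variable {X : Type} [NormedAddCommGroup X] [NormedSpace ℝ X] {F : X → ℝ × ℝ → X}
  {h : X → ℝ × ℝ → ℝ × ℝ} {βs : P.State} {j : G ⊕ L} (pr : P.DiffState →L[ℝ] X)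

/-- An abstract projection `pr` treats buses with and without inertia alike: `hF` and `hh` say that
it intertwines dynamics and outputs, `hpr` that it determines the bus state. The storage function is
pulled back along it. -/
theorem exists_isBusStorage {φ : ℝ × ℝ → ℝ}
    (hF : ∀ β, pr (P.field β) = F (pr (P.diffPart β)) (P.ζ β j))
    (hh : ∀ β, h (pr (P.diffPart β)) (P.ζ β j) = (P.s β j, -P.du β j))
    (hpr : ∀ z, pr z = pr (P.diffPart βs) →
      (∀ i, j = .inl i → z.2.2.2.1 i = P.xM βs i) ∧ z.2.2.2.2.1 j = P.xc βs j ∧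
      z.2.2.2.2.2.1 j = P.xu βs j)
    (hd : LocallyDissipative F h (P.ζ βs j) (pr (P.diffPart βs))
      (supplyRate φ (P.ζ βs j) (h (pr (P.diffPart βs)) (P.ζ βs j)))) :
    ∃ U, IsBusStorage βs j U φ := by
  obtain ⟨U₀, X₀, V, hU₀, hζ, hX₀, hx, hV, hmin, hle⟩ := hd
  have hVd : Differentiable ℝ V := hV.differentiable one_ne_zero
  have hmin' : ∀ᶠ z in 𝓝 (P.diffPart βs), pr z ≠ pr (P.diffPart βs) →
      V (pr (P.diffPart βs)) < V (pr z) :=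
    pr.continuous.continuousAt.eventually (eventually_nhdsWithin_iff.1 hmin)
  refine ⟨V ∘ pr, hVd.comp pr.differentiable, ?_, ?_, ?_⟩
  · filter_upwards [hmin'] with z hz
    by_cases h : pr z = pr (P.diffPart βs)
    · simp [h]
    · exact (hz h).le
  · filter_upwards [hmin'] with z hz heq
    by_contra hcon
    exact absurd heq (hz fun h => hcon (hpr z h)).ne'
  · have h1 : ∀ᶠ β in 𝓝 βs, P.ζ β j ∈ U₀ :=
      (P.continuous_ζ j).continuousAt.eventually (hU₀.mem_nhds hζ)
    have h2 : ∀ᶠ β in 𝓝 βs, pr (P.diffPart β) ∈ X₀ :=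
      (pr.continuous.comp P.continuous_diffPart).continuousAt.eventually (hX₀.mem_nhds hx)
    filter_upwards [h1, h2] with β hβ1 hβ2
    have h3 := hle _ hβ1 _ hβ2
    rw [← hF, hh, hh] at h3
    rwa [((hVd _).hasFDerivAt.comp (P.diffPart β) pr.hasFDerivAt).fderiv]

theorem excludesSinusoidsAt
    (hF : ∀ β, pr (P.field β) = F (pr (P.diffPart β)) (P.ζ β j))
    (hh : ∀ β, h (pr (P.diffPart β)) (P.ζ β j) = (P.s β j, -P.du β j))
    (he : ExcludesSinusoids F h (P.ζ βs j) (pr (P.diffPart βs))) : ExcludesSinusoidsAt βs j := by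
  obtain ⟨U₀, hU₀, X₀, hX₀, he⟩ := he
  refine ⟨{β | pr (P.diffPart β) ∈ X₀ ∧ P.ζ β j ∈ U₀}, ?_, ?_⟩
  · exact ((pr.continuous.comp P.continuous_diffPart).continuousAt.eventually hX₀).and
      ((P.continuous_ζ j).continuousAt.eventually hU₀)
  · rintro β hβ hO ⟨w, hw⟩ ⟨c, hc⟩
    have hζ : ∀ t, (-w, P.pc (β t) j) = P.ζ (β t) j := fun t => by rw [ζ, hw]
    refine he (fun t => pr (P.diffPart (β t))) w _ c (fun t => ?_) (fun t => ?_) fun t => ?_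
    · rw [hζ, ← hF]
      exact pr.hasFDerivAt.comp_hasDerivAt t
        (hasDerivWithinAt_univ.1
        (hβ.hasDerivWithinAt_diffPart (mem_univ t)))
    · rw [hζ]
      exact hO t
    · rw [hζ, hh, hc]

end

/-- What the dissipativity conditions provide at each bus. -/
theorem exists_busStorage {βs : P.State} {j : G ⊕ L}
    (h : P.BusConditionA βs j ∨ P.BusConditionB βs j) :
    ∃ (φ : ℝ × ℝ → ℝ) (U : P.DiffState → ℝ), IsBusStorage βs j U φ ∧ (∀ z, 0 ≤ φ z) ∧
      (∀ z, z.1 ≠ 0 → 0 < φ z) ∧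
      (P.BusConditionA βs j → ∀ z, z ≠ 0 → 0 < φ z) ∧
      (¬ P.BusConditionA βs j → ExcludesSinusoidsAt βs j) := by
  have hnn : ∀ φ : ℝ × ℝ → ℝ, φ 0 = 0 → (∀ z, z ≠ 0 → 0 < φ z) → ∀ z, 0 ≤ φ z := by
    intro φ h0 h1 z
    rcases eq_or_ne z 0 with rfl | hz
    · exact h0.ge
    · exact (h1 z hz).le
  have hne : ∀ z : ℝ × ℝ, z.1 ≠ 0 → z ≠ 0 := fun z hz h => hz (by rw [h]; rfl)
  cases j with
  | inl j =>
    have hF : ∀ β, P.genBusProj j (P.field β) =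
      P.genBusField j (P.genBusProj j (P.diffPart β)) (P.ζ β (.inl j)) := fun β => rfl
    have hh : ∀ β, P.genBusOutput j (P.genBusProj j (P.diffPart β)) (P.ζ β (.inl j)) =
        (P.s β (.inl j), -P.du β (.inl j)) := fun β => by
      rw [du, neg_neg]
      rfl
    have hpr : ∀ z, P.genBusProj j z = P.genBusProj j (P.diffPart βs) →
        (∀ i, Sum.inl (β := L) j = .inl i → z.2.2.2.1 i = P.xM βs i) ∧
          z.2.2.2.2.1 (.inl j) = P.xc βs (.inl j) ∧
          z.2.2.2.2.2.1 (.inl j) = P.xu βs (.inl j) := by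
      intro z hz
      refine ⟨fun i hi => ?_, congr_arg (fun x => x.2.1) hz, congr_arg (fun x => x.2.2) hz⟩
      cases hi
      exact congr_arg (fun x => x.1) hz
    -- Condition (a) takes precedence, so that the chosen φ is positive definite whenever (a) holds.
    by_cases hA : P.BusConditionA βs (.inl j)
    · obtain ⟨φ, h0, h1, hd⟩ := id hA
      obtain ⟨U, hU⟩ := exists_isBusStorage (P.genBusProj j) hF hh hpr hd
      exact ⟨φ, U, hU, hnn φ h0 h1, fun z hz => h1 z (hne z hz), fun _ => h1,
        fun h => absurd hA h⟩
    · obtain ⟨⟨φ, h0, h1, hd⟩, he⟩ := h.resolve_left hA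
      obtain ⟨U, hU⟩ := exists_isBusStorage (P.genBusProj j) hF hh hpr hd
      exact ⟨φ, U, hU, h0, h1, fun h => absurd h hA,
        fun _ => excludesSinusoidsAt (P.genBusProj j) hF hh he⟩
  | inr j =>
    have hF : ∀ β, P.loadBusProj j (P.field β) =
      P.loadBusField j (P.loadBusProj j (P.diffPart β)) (P.ζ β (.inr j)) := fun β => rfl
    have hh : ∀ β, P.loadBusOutput j (P.loadBusProj j (P.diffPart β)) (P.ζ β (.inr j)) =
        (P.s β (.inr j), -P.du β (.inr j)) := fun β => by
      rw [du, neg_neg]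
      rfl
    have hpr : ∀ z, P.loadBusProj j z = P.loadBusProj j (P.diffPart βs) →
        (∀ i, Sum.inr (α := G) j = .inl i → z.2.2.2.1 i = P.xM βs i) ∧
          z.2.2.2.2.1 (.inr j) = P.xc βs (.inr j) ∧
          z.2.2.2.2.2.1 (.inr j) = P.xu βs (.inr j) := fun z hz =>
      ⟨fun i hi => (Sum.inr_ne_inl hi).elim, congr_arg (fun x => x.1) hz,
        congr_arg (fun x => x.2) hz⟩
    by_cases hA : P.BusConditionA βs (.inr j)
    · obtain ⟨φ, h0, h1, hd⟩ := id hA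
      obtain ⟨U, hU⟩ := exists_isBusStorage (P.loadBusProj j) hF hh hpr hd
      exact ⟨φ, U, hU, hnn φ h0 h1, fun z hz => h1 z (hne z hz), fun _ => h1,
        fun h => absurd hA h⟩
    · obtain ⟨⟨φ, h0, h1, hd⟩, he⟩ := h.resolve_left hA
      obtain ⟨U, hU⟩ := exists_isBusStorage (P.loadBusProj j) hF hh hpr hd
      exact ⟨φ, U, hU, h0, h1, fun h => absurd h hA,
        fun _ => excludesSinusoidsAt (P.loadBusProj j) hF hh he⟩

end PowerNetwork

end Storage

/-! ### The Lyapunov function of the network -/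

section LyapunovFunction

namespace PowerNetwork

variable {G L : Type} [Fintype G] [Fintype L]
  {P : PowerNetwork G L}

/-- The Lyapunov function built from the kinetic energy, the potential energy of the lines, the
power command variables and storage functions `U j` at the buses. -/
noncomputable def lyapunov (βs : P.State) (U : G ⊕ L → P.DiffState → ℝ) (z : P.DiffState) : ℝ :=
  ∑ j : G, P.M j / 2 * (z.2.2.1 j - P.ω βs (.inl j)) ^ 2 +
  ∑ e, P.B e * (-Real.cos (z.1 e) - Real.sin (P.η βs e) * z.1 e) +
  ∑ j, P.γ j / 2 * (z.2.2.2.2.2.2 j - P.pc βs j) ^ 2 +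
  ∑ e, P.γe e / 2 * (z.2.1 e - P.ψ βs e) ^ 2 +
  ∑ j, U j z

theorem hasDerivAt_half_mul_sq (c a x : ℝ) :
    HasDerivAt (fun x => c / 2 * (x - a) ^ 2) (c * (x - a)) x := by
  refine ((((hasDerivAt_id x).sub_const a).fun_pow 2).const_mul (c / 2)).congr_deriv ?_
  simp
  ring

theorem hasFDerivAt_lyapunov {βs : P.State} {U : G ⊕ L → P.DiffState → ℝ}
    (hU : ∀ j, Differentiable ℝ (U j)) (z : P.DiffState) :
    ∃ V' : P.DiffState →L[ℝ] ℝ, HasFDerivAt (lyapunov βs U) V' z ∧ ∀ v, V' v =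
      ∑ j : G, P.M j * (z.2.2.1 j - P.ω βs (.inl j)) * v.2.2.1 j +
      ∑ e, P.B e * (Real.sin (z.1 e) - Real.sin (P.η βs e)) * v.1 e +
      ∑ j, P.γ j * (z.2.2.2.2.2.2 j - P.pc βs j) * v.2.2.2.2.2.2 j +
      ∑ e, P.γe e * (z.2.1 e - P.ψ βs e) * v.2.1 e +
      ∑ j, fderiv ℝ (U j) z v := by
  let l₁ : P.DiffState →L[ℝ] (P.line.edges → ℝ) := ContinuousLinearMap.fst ℝ _ _
  let tail := ContinuousLinearMap.snd ℝ (P.line.edges → ℝ) ((P.comm.edges → ℝ) × (G → ℝ) ×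
      ((j : G) → (P.gen j).X) × ((j : G ⊕ L) → (P.load j).X) × ((j : G ⊕ L) → (P.unc j).X) ×
      (G ⊕ L → ℝ))
  let l₂ : P.DiffState →L[ℝ] (P.comm.edges → ℝ) := (ContinuousLinearMap.fst ℝ _ _).comp tail
  let tail₂ := (ContinuousLinearMap.snd ℝ _ _).comp tail
  let l₃ : P.DiffState →L[ℝ] (G → ℝ) := (ContinuousLinearMap.fst ℝ _ _).comp tail₂
  let l₇ : P.DiffState →L[ℝ] (G ⊕ L → ℝ) := (ContinuousLinearMap.snd ℝ _ _).comp
    ((ContinuousLinearMap.snd ℝ _ _).comp ((ContinuousLinearMap.snd ℝ _ _).comp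
    ((ContinuousLinearMap.snd ℝ _ _).comp tail₂)))
  have h1 := hasFDerivAt_sum_comp (fun j : G => hasDerivAt_half_mul_sq (P.M j) (P.ω βs (.inl j)))
    (fun j => (ContinuousLinearMap.proj j).comp l₃) z
  have h2 := hasFDerivAt_sum_comp
    (F := fun e x => P.B e * (-Real.cos x - Real.sin (P.η βs e) * x))
    (F' := fun e x => P.B e * (Real.sin x - Real.sin (P.η βs e)))
    (fun e x => by
      refine HasDerivAt.const_mul _ ?_
      simpa using (Real.hasDerivAt_cos x).fun_neg.fun_sub
        ((hasDerivAt_id x).const_mul (Real.sin (P.η βs e))))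
    (fun e => (ContinuousLinearMap.proj e).comp l₁) z
  have h3 := hasFDerivAt_sum_comp (fun j => hasDerivAt_half_mul_sq (P.γ j) (P.pc βs j))
    (fun j => (ContinuousLinearMap.proj j).comp l₇) z
  have h4 := hasFDerivAt_sum_comp (fun e => hasDerivAt_half_mul_sq (P.γe e) (P.ψ βs e))
    (fun e => (ContinuousLinearMap.proj e).comp l₂) z
  have h5 : HasFDerivAt (fun z => ∑ j, U j z) (∑ j, fderiv ℝ (U j) z) z :=
    HasFDerivAt.fun_sum fun j _ => (hU j z).hasFDerivAt
  refine ⟨_, (((h1.fun_add h2).fun_add h3).fun_add h4).fun_add h5, fun v => ?_⟩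
  simp only [_root_.add_apply, _root_.sum_apply, _root_.smul_apply, smul_eq_mul]
  rfl

theorem differentiable_lyapunov {βs : P.State} {U : G ⊕ L → P.DiffState → ℝ}
    (hU : ∀ j, Differentiable ℝ (U j)) : Differentiable ℝ (lyapunov βs U) := fun z =>
  let ⟨_, h, _⟩ := hasFDerivAt_lyapunov hU z
  h.differentiableAt

variable [DecidableEq G] [DecidableEq L]

/-- The power transfers and the incremental supplies cancel in the energy balance. -/
theorem energy_balance {β βs : P.State} (heq : P.IsEquilibrium βs)
    (hβ : P.AlgebraicEquations β) :
    ∑ j : G, P.ω β (.inl j) * P.balance β (.inl j) +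
      ∑ e, P.B e * (Real.sin (P.η β e) - Real.sin (P.η βs e)) *
        (P.ω β e.1.1 - P.ω β e.1.2) +
      ∑ j, (P.pc β j - P.pc βs j) * P.commandBalance β j +
      ∑ e, (P.ψ β e - P.ψ βs e) * (P.pc β e.1.1 - P.pc β e.1.2) +
      ∑ j, ((P.s β j - P.s βs j) * (-P.ω β j + (P.pc β j - P.pc βs j)) +
        (P.du β j - P.du βs j) * P.ω β j) = 0 := by
  -- The algebraic equations allow the sum to run over all buses; this is how the frequencies on L
  -- enter although V does not contain them.
  have h1 : ∑ j : G, P.ω β (.inl j) * P.balance β (.inl j) =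
      ∑ j, P.ω β j * (P.balance β j - P.balance βs j) := by
    rw [Fintype.sum_sum_type]
    have : ∀ j : L, P.balance β (.inr j) = 0 := hβ
    simp [heq.balance_eq, this]
  have h2 : ∑ j, P.ω β j * (P.balance β j - P.balance βs j) =
      ∑ j, P.ω β j * ((P.s β j - P.s βs j) - (P.du β j - P.du βs j)) -
      ∑ e, P.B e * (Real.sin (P.η β e) - Real.sin (P.η βs e)) *
        (P.ω β e.1.1 - P.ω β e.1.2) := by
    have h3 := P.line.sum_mul_netInflow (P.ω β) (fun e => P.flow β e - P.flow βs e)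
    have h4 : ∀ e, P.flow β e - P.flow βs e =
        P.B e * (Real.sin (P.η β e) - Real.sin (P.η βs e)) := fun e => by
      simp only [flow]
      ring
    simp only [h4] at h3
    rw [sub_eq_add_neg, ← h3, ← Finset.sum_add_distrib]
    refine Finset.sum_congr rfl fun j _ => ?_
    simp only [← h4, P.line.netInflow_sub, balance]
    ring
  have h5 : ∑ j, (P.pc β j - P.pc βs j) * P.commandBalance β j =
      -∑ j, (P.pc β j - P.pc βs j) * (P.s β j - P.s βs j) -
      ∑ e, (P.ψ β e - P.ψ βs e) * (P.pc β e.1.1 - P.pc β e.1.2) := by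
    have h6 := P.comm.sum_mul_netInflow (fun j => P.pc β j - P.pc βs j)
      (fun e => P.ψ β e - P.ψ βs e)
    -- The power command is uniform at equilibrium, so its equilibrium values drop out of edge
    -- differences.
    have h7 : ∀ e : P.comm.edges, P.pc β e.1.1 - P.pc βs e.1.1 - (P.pc β e.1.2 - P.pc βs e.1.2) =
        P.pc β e.1.1 - P.pc β e.1.2 := fun e => by
      rw [heq.pc_eq_pc e.1.1 e.1.2]
      ring
    simp only [h7] at h6
    rw [sub_eq_add_neg, ← h6, ← Finset.sum_neg_distrib, ← Finset.sum_add_distrib]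
    refine Finset.sum_congr rfl fun j _ => ?_
    have h8 := heq.pc_eq j
    simp only [P.comm.netInflow_sub]
    simp only [commandBalance] at h8 ⊢
    linear_combination (P.pc β j - P.pc βs j) * h8
  rw [h1, h2, h5]
  have h9 : ∑ j, ((P.s β j - P.s βs j) * (-P.ω β j + (P.pc β j - P.pc βs j)) +
        (P.du β j - P.du βs j) * P.ω β j) =
      -∑ j, P.ω β j * ((P.s β j - P.s βs j) - (P.du β j - P.du βs j)) +
      ∑ j, (P.pc β j - P.pc βs j) * (P.s β j - P.s βs j) := by
    rw [← Finset.sum_neg_distrib, ← Finset.sum_add_distrib]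
    exact Finset.sum_congr rfl fun j _ => by ring
  rw [h9]
  ring

/-- The storage inequalities bound the bus terms by supply rates; by `energy_balance` everything but
the φ_j then cancels. -/
theorem fderiv_lyapunov_le {βs : P.State} (heq : P.IsEquilibrium βs) (hωs : P.ω βs = 0)
    {U : G ⊕ L → P.DiffState → ℝ} {φ : G ⊕ L → ℝ × ℝ → ℝ}
    (hU : ∀ j, IsBusStorage βs j (U j) (φ j)) :
    ∀ᶠ β in 𝓝 βs, P.AlgebraicEquations β →
      fderiv ℝ (lyapunov βs U) (P.diffPart β) (P.field β) ≤
        -∑ j, φ j (P.ζ β j - P.ζ βs j) := by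
  filter_upwards [eventually_all.2 fun j => (hU j).fderiv_le] with β hβ halg
  obtain ⟨V', hV', hv⟩ := hasFDerivAt_lyapunov (βs := βs)
    (fun j => (hU j).differentiable) (P.diffPart β)
  rw [hV'.fderiv, hv]
  have hle := Finset.sum_le_sum fun j (_ : j ∈ Finset.univ) => hβ j
  have hsupply : ∀ j, supplyRate (φ j) (P.ζ βs j) (P.s βs j, -P.du βs j) (P.ζ β j)
      (P.s β j, -P.du β j) =
      ((P.s β j - P.s βs j) * (-P.ω β j + (P.pc β j - P.pc βs j)) +
        (P.du β j - P.du βs j) * P.ω β j) - φ j (P.ζ β j - P.ζ βs j) := fun j => by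
    simp only [supplyRate, ζ, hωs, Pi.zero_apply]
    ring
  simp only [hsupply, Finset.sum_sub_distrib] at hle
  have hbal := energy_balance heq halg
  have h1 : ∑ j : G, P.M j * ((P.diffPart β).2.2.1 j - P.ω βs (.inl j)) * (P.field β).2.2.1 j =
      ∑ j : G, P.ω β (.inl j) * P.balance β (.inl j) := by
    refine Finset.sum_congr rfl fun j _ => ?_
    have := (P.M_pos j).ne'
    simp only [hωs, Pi.zero_apply, sub_zero, field, diffPart]
    field_simp
  have h2 : ∑ j, P.γ j * ((P.diffPart β).2.2.2.2.2.2 j - P.pc βs j) *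
      (P.field β).2.2.2.2.2.2 j = ∑ j, (P.pc β j - P.pc βs j) * P.commandBalance β j := by
    refine Finset.sum_congr rfl fun j _ => ?_
    have := (P.γ_pos j).ne'
    simp only [field, diffPart]
    field_simp
  have h3 : ∑ e, P.γe e * ((P.diffPart β).2.1 e - P.ψ βs e) * (P.field β).2.1 e =
      ∑ e, (P.ψ β e - P.ψ βs e) * (P.pc β e.1.1 - P.pc β e.1.2) := by
    refine Finset.sum_congr rfl fun e _ => ?_
    have := (P.γe_pos e).ne'
    simp only [field, diffPart]
    field_simp
  have h4 : ∑ e, P.B e * (Real.sin ((P.diffPart β).1 e) - Real.sin (P.η βs e)) *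
      (P.field β).1 e = ∑ e, P.B e * (Real.sin (P.η β e) - Real.sin (P.η βs e)) *
        (P.ω β e.1.1 - P.ω β e.1.2) := rfl
  rw [h1, h2, h3, h4]
  linarith

/-- Each summand is separately minimal at `βs`, so equality of the sums forces equality in every
summand, and these fix all coordinates. -/
theorem lyapunov_lt {βs : P.State} (hη : ∀ e, |P.η βs e| < Real.pi / 2)
    {U : G ⊕ L → P.DiffState → ℝ} {φ : G ⊕ L → ℝ × ℝ → ℝ}
    (hU : ∀ j, IsBusStorage βs j (U j) (φ j)) :
    ∀ᶠ z in 𝓝 (P.diffPart βs), z ≠ P.diffPart βs →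
      lyapunov βs U (P.diffPart βs) < lyapunov βs U z := by
  have hη' : ∀ᶠ z in 𝓝 (P.diffPart βs), ∀ e, |z.1 e| < Real.pi / 2 :=
    eventually_all.2 fun e =>
      (by fun_prop : Continuous fun z : P.DiffState => |z.1 e|).continuousAt.eventually
        (gt_mem_nhds (hη e))
  filter_upwards [eventually_all.2 fun j => (hU j).isLocalMin,
    eventually_all.2 fun j => (hU j).eq_of_eq, hη'] with z hmin heq hz hne
  by_contra hcon
  refine hne ?_
  rw [not_lt] at hcon
  have a1 : ∀ j ∈ Finset.univ, 0 ≤ P.M j / 2 * (z.2.2.1 j - P.ω βs (.inl j)) ^ 2 := fun j _ =>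
    mul_nonneg (half_pos (P.M_pos j)).le (sq_nonneg _)
  have a2 : ∀ e ∈ Finset.univ, 0 ≤ P.B e * (-Real.cos (z.1 e) - Real.sin (P.η βs e) * z.1 e) -
      P.B e * (-Real.cos (P.η βs e) - Real.sin (P.η βs e) * P.η βs e) := fun e _ => by
    rw [← mul_sub]
    refine mul_nonneg (P.B_pos e).le (sub_nonneg.2 ?_)
    by_cases h : z.1 e = P.η βs e
    · rw [h]
    · exact (neg_cos_sub_lt (hη e) (hz e) h).le
  have a3 : ∀ j ∈ Finset.univ, 0 ≤ P.γ j / 2 * (z.2.2.2.2.2.2 j - P.pc βs j) ^ 2 := fun j _ =>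
    mul_nonneg (half_pos (P.γ_pos j)).le (sq_nonneg _)
  have a4 : ∀ e ∈ Finset.univ, 0 ≤ P.γe e / 2 * (z.2.1 e - P.ψ βs e) ^ 2 := fun e _ =>
    mul_nonneg (half_pos (P.γe_pos e)).le (sq_nonneg _)
  have a5 : ∀ j ∈ Finset.univ, 0 ≤ U j z - U j (P.diffPart βs) := fun j _ =>
    sub_nonneg.2 (hmin j)
  have b1 := Finset.sum_nonneg a1
  have b2 := Finset.sum_nonneg a2
  have b3 := Finset.sum_nonneg a3
  have b4 := Finset.sum_nonneg a4
  have b5 := Finset.sum_nonneg a5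
  have hs : lyapunov βs U (P.diffPart βs) =
      ∑ e, P.B e * (-Real.cos (P.η βs e) - Real.sin (P.η βs e) * P.η βs e) +
        ∑ j, U j (P.diffPart βs) := by
    simp [lyapunov, diffPart]
  rw [hs, lyapunov] at hcon
  rw [Finset.sum_sub_distrib] at b2 b5
  have c1 := (Finset.sum_eq_zero_iff_of_nonneg a1).1 (by linarith)
  have c2 := (Finset.sum_eq_zero_iff_of_nonneg a2).1 (by rw [Finset.sum_sub_distrib]; linarith)
  have c3 := (Finset.sum_eq_zero_iff_of_nonneg a3).1 (by linarith)
  have c4 := (Finset.sum_eq_zero_iff_of_nonneg a4).1 (by linarith)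
  have c5 := (Finset.sum_eq_zero_iff_of_nonneg a5).1 (by rw [Finset.sum_sub_distrib]; linarith)
  have hbus := fun j => heq j (sub_eq_zero.1 (c5 j (Finset.mem_univ j)))
  refine Prod.ext (funext fun e => ?_) (Prod.ext (funext fun e => ?_) (Prod.ext
    (funext fun j => ?_) (Prod.ext (funext fun j => (hbus (.inl j)).1 j rfl) (Prod.ext
    (funext fun j => (hbus j).2.1) (Prod.ext (funext fun j => (hbus j).2.2)
    (funext fun j => ?_))))))
  · by_contra h
    have h1 := neg_cos_sub_lt (hη e) (hz e) h
    have h2 := c2 e (Finset.mem_univ e)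
    rw [← mul_sub] at h2
    exact absurd h2 (mul_pos (P.B_pos e) (sub_pos.2 h1)).ne'
  · have := (mul_eq_zero.1 (c4 e (Finset.mem_univ e))).resolve_left (half_pos (P.γe_pos e)).ne'
    exact sub_eq_zero.1 (pow_eq_zero_iff two_ne_zero |>.1 this)
  · have := (mul_eq_zero.1 (c1 j (Finset.mem_univ j))).resolve_left (half_pos (P.M_pos j)).ne'
    exact sub_eq_zero.1 (pow_eq_zero_iff two_ne_zero |>.1 this)
  · have := (mul_eq_zero.1 (c3 j (Finset.mem_univ j))).resolve_left (half_pos (P.γ_pos j)).ne'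
    exact sub_eq_zero.1 (pow_eq_zero_iff two_ne_zero |>.1 this)

end PowerNetwork

end LyapunovFunction

/-! ### Trajectories without dissipation are equilibria -/

section Invariance

theorem eq_of_hasDerivAt_zero {E : Type*} [NormedAddCommGroup E] [NormedSpace ℝ E] {x : ℝ → E}
    (h : ∀ t, HasDerivAt x 0 t) (s t : ℝ) : x s = x t :=
  is_const_of_deriv_eq_zero (fun t => (h t).differentiableAt) (fun t => (h t).deriv) s t

/-- A neighbourhood of `kx ubar` lies in the region of attraction for `ubar`, or for all inputs near
`ubar` under the common region assumption. -/
theorem DynSys.exists_nhds_subset_regionOfAttraction {U : Type} [NormedAddCommGroup U]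
    (S : DynSys U) {ubar : U} {Q : Prop} (h : ¬ Q → S.HasCommonRegionOfAttraction ubar) :
    ∃ X₀ ∈ 𝓝 (S.kx ubar), ∃ Z ∈ 𝓝 ubar, ∀ u ∈ Z, (Q → u = ubar) →
      X₀ ⊆ regionOfAttraction (fun x => S.f x u) (S.kx u) := by
  -- Q will say that (a) holds at some bus. In that case only the input `ubar` has to be considered,
  -- and its local asymptotic stability suffices.
  by_cases hQ : Q
  · refine ⟨_, (S.stable ubar).2, univ, univ_mem, fun u _ hu => ?_⟩
    rw [hu hQ]
  · obtain ⟨X₀, hX₀, hZ⟩ := h hQ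
    exact ⟨X₀, hX₀, _, hZ, fun u hu _ => hu⟩

namespace PowerNetwork

variable {G L : Type} [Fintype G] [Fintype L] [DecidableEq G] [DecidableEq L]
  {P : PowerNetwork G L}

/-- Complete trajectories near `βs` along which nothing is dissipated are equilibria. -/
theorem isEquilibrium_of_complete {βs : P.State} (heq : P.IsEquilibrium βs) (hωs : P.ω βs = 0)
    {φ : G ⊕ L → ℝ × ℝ → ℝ} (hφ : ∀ j z, z.1 ≠ 0 → 0 < φ j z)
    (hA : ∀ j, P.BusConditionA βs j → ∀ z, z ≠ 0 → 0 < φ j z)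
    (hB : ∀ j, ¬ P.BusConditionA βs j → ExcludesSinusoidsAt βs j)
    (hX₀ : (∀ j, ¬ P.BusConditionA βs j) → P.HasCommonRegionsOfAttraction βs) :
    ∃ O ∈ 𝓝 βs, ∀ C ⊆ O, IsCompact C → ∀ β : ℝ → P.State, P.IsSolution univ β →
      (∀ t, β t ∈ C) → (∀ t j, φ j (P.ζ (β t) j - P.ζ βs j) = 0) → ∀ t, P.IsEquilibrium (β t) := by
  classical
  have hX₀' : ¬ (∃ j, P.BusConditionA βs j) → P.HasCommonRegionsOfAttraction βs :=
    fun h => hX₀ (not_exists.1 h)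
  have hgen := fun j => (P.gen j).exists_nhds_subset_regionOfAttraction fun h => (hX₀' h).1 j
  have hload := fun j => (P.load j).exists_nhds_subset_regionOfAttraction fun h => (hX₀' h).2 j
  choose XM hXM ZM hZM hMattr using hgen
  choose XC hXC ZC hZC hCattr using hload
  choose! OB hOB hexcl using hB
  have hxMs : ∀ j, P.xM βs j = (P.gen j).kx (P.ζ βs (.inl j)) := fun j =>
    ((P.gen j).equilibrium_iff _ _).1 (heq.xM_eq j)
  have hxcs : ∀ j, P.xc βs j = (P.load j).kx (P.ζ βs j) := fun j =>
    ((P.load j).equilibrium_iff _ _).1 (heq.xc_eq j)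
  have hxus : ∀ j, P.xu βs j = (P.unc j).kx 0 := fun j => by
    have := ((P.unc j).equilibrium_iff _ _).1 (heq.xu_eq j)
    rwa [hωs, Pi.zero_apply, neg_zero] at this
  have e1 : ∀ᶠ β in 𝓝 βs, ∀ j, P.xM β j ∈ XM j := eventually_all.2 fun j =>
    (by fun_prop : Continuous fun β : P.State => P.xM β j).continuousAt.eventually
      ((hxMs j).symm ▸ hXM j : XM j ∈ 𝓝 (P.xM βs j))
  have e2 : ∀ᶠ β in 𝓝 βs, ∀ j, P.ζ β (.inl j) ∈ ZM j := eventually_all.2 fun j =>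
    (P.continuous_ζ _).continuousAt.eventually (hZM j)
  have e3 : ∀ᶠ β in 𝓝 βs, ∀ j, P.xc β j ∈ XC j := eventually_all.2 fun j =>
    (by fun_prop : Continuous fun β : P.State => P.xc β j).continuousAt.eventually
      ((hxcs j).symm ▸ hXC j : XC j ∈ 𝓝 (P.xc βs j))
  have e4 : ∀ᶠ β in 𝓝 βs, ∀ j, P.ζ β j ∈ ZC j := eventually_all.2 fun j =>
    (P.continuous_ζ _).continuousAt.eventually (hZC j)
  have e5 : ∀ᶠ β in 𝓝 βs, ∀ j,
      P.xu β j ∈ regionOfAttraction (fun x => (P.unc j).f x 0) ((P.unc j).kx 0) :=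
    eventually_all.2 fun j =>
      (by fun_prop : Continuous fun β : P.State => P.xu β j).continuousAt.eventually
        ((hxus j).symm ▸ ((P.unc j).stable 0).2 : _ ∈ 𝓝 (P.xu βs j))
  have e6 : ∀ᶠ β in 𝓝 βs, ∀ j, ¬ P.BusConditionA βs j → β ∈ OB j := eventually_all.2 fun j => by
    by_cases h : P.BusConditionA βs j
    · exact Eventually.of_forall fun _ h' => absurd h h'
    · filter_upwards [hOB j h] with β hβ _ using hβ
  refine ⟨_, e1.and (e2.and (e3.and (e4.and (e5.and e6)))), fun C hCO hC β hβ hβC hzero => ?_⟩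
  -- frequencies
  have hω : ∀ t j, P.ω (β t) j = 0 := by
    intro t j
    by_contra h
    refine (hφ j (P.ζ (β t) j - P.ζ βs j) ?_).ne' (hzero t j)
    simpa [ζ, hωs] using h
  have hη : ∀ t e, P.η (β t) e = P.η (β 0) e := fun t e => by
    refine eq_of_hasDerivAt_zero (x := fun t => P.η (β t) e) (fun t => ?_) t 0
    have := hasDerivWithinAt_univ.1 (hβ.η_deriv t (mem_univ t) e)
    rwa [hω, hω, sub_zero] at this
  -- uncontrollable demand
  have hxu : ∀ t j, P.xu (β t) j = (P.unc j).kx 0 := by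
    intro t j
    refine eq_of_mem_regionOfAttraction ((P.unc j).locallyLipschitz_f 0) ((P.unc j).stable 0)
      (x := fun t => P.xu (β t) j) (fun t _ => ?_) (hC.image (f := fun β : P.State => P.xu β j)
      (by fun_prop)) ?_ (fun t => mem_image_of_mem _ (hβC t)) t
    · have := hβ.xu_deriv t (mem_univ t) j
      rwa [hω, neg_zero] at this
    · rintro _ ⟨γ, hγ, rfl⟩
      exact (hCO hγ).2.2.2.2.1 j
  have hdu : ∀ t j, P.du (β t) j = P.du (β 0) j := fun t j => by
    simp only [du, hxu, hω]
  -- net supply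
  have hbal : ∀ t j, P.balance (β t) j = 0 := by
    rintro t (j | j)
    · have h1 := hasDerivWithinAt_univ.1 (hβ.ω_deriv t (mem_univ t) j)
      have h2 : (fun r => P.ω (β r) (.inl j)) = fun _ => 0 := funext fun r => hω r _
      rw [h2] at h1
      exact (div_eq_zero_iff.1 (h1.unique (hasDerivAt_const t 0))).resolve_right (P.M_pos j).ne'
    · exact hβ.algebraic t (mem_univ t) j
  have hflow : ∀ t, P.flow (β t) = P.flow (β 0) := fun t => by
    funext e
    simp only [flow, hη t e]
  -- In the power balance everything except s is now known to be constant.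
  have hs : ∀ t j, P.s (β t) j = P.s (β 0) j := by
    intro t j
    have h1 := hbal t j
    have h2 := hbal 0 j
    simp only [balance, hflow t, hdu t j] at h1 h2
    linarith
  -- power command
  obtain ⟨R, hR⟩ :=
    (hC.image (f := fun β : P.State => P.pc β) (by fun_prop)).isBounded.exists_norm_le
  obtain ⟨R', hR'⟩ :=
    (hC.image (f := fun β : P.State => P.ψ β) (by fun_prop)).isBounded.exists_norm_le
  have hpc : ∀ t j, P.pc (β t) j = P.pc (β 0) j := by
    intro t j
    -- Under (a), φ_j = 0 fixes pᶜ_j. Otherwise constancy of s makes pᶜ_j a finite sum of sinusoids,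
    -- and (b) leaves only constant ones.
    by_cases h : P.BusConditionA βs j
    · have hz : ∀ t, P.pc (β t) j = P.pc βs j := by
        intro t
        by_contra hne
        refine (hA j h _ fun h0 => hne ?_).ne' (hzero t j)
        exact sub_eq_zero.1 (congr_arg Prod.snd h0)
      rw [hz, hz]
    · have hsin := P.comm.exists_sum_sin_of_consensus P.γ_pos P.γe_pos
        (b := fun j => -(P.s (β 0) j - P.pL j)) (p := fun t => P.pc (β t))
        (ψ := fun t => P.ψ (β t)) (R := R)
        (fun t j => by
          rw [← hs t j]
          exact hasDerivWithinAt_univ.1 (hβ.pc_deriv t (mem_univ t) j))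
        (fun t e => hasDerivWithinAt_univ.1 (hβ.ψ_deriv t (mem_univ t) e))
        (fun t j => (norm_le_pi_norm (P.pc (β t)) j).trans
          (hR _ (mem_image_of_mem _ (hβC t)))) j
      have hnot := hexcl j h β hβ (fun t => (hCO (hβC t)).2.2.2.2.2 j h) ⟨0, fun t => hω t j⟩
        ⟨_, fun t => hs t j⟩
      obtain ⟨c, hc⟩ : ∃ c, ∀ t, P.pc (β t) j = c := by
        by_contra hcon
        exact hnot ⟨hsin, hcon⟩
      rw [hc, hc]
  have hedge : ∀ t (e : P.comm.edges), P.pc (β t) e.1.1 - P.pc (β t) e.1.2 = 0 := by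
    intro t e
    have h1 : (P.pc (β 0) e.1.1 - P.pc (β 0) e.1.2) / P.γe e = 0 := by
      -- With constant power commands ψ has a constant derivative; being bounded, it must be
      -- constant.
      refine eq_zero_of_hasDerivAt_const_of_bounded (f := fun t => P.ψ (β t) e) (R := R')
        (fun t => ?_) fun t => (norm_le_pi_norm (P.ψ (β t)) e).trans
          (hR' _ (mem_image_of_mem _ (hβC t)))
      have := hasDerivWithinAt_univ.1 (hβ.ψ_deriv t (mem_univ t) e)
      rwa [hpc t e.1.1, hpc t e.1.2] at this
    rw [hpc t e.1.1, hpc t e.1.2]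
    exact (div_eq_zero_iff.1 h1).resolve_right (P.γe_pos e).ne'
  have hζ : ∀ t j, P.ζ (β t) j = P.ζ (β 0) j := fun t j => by
    simp only [ζ, hω, hpc t j]
  -- One bus with (a) fixes the power command everywhere by connectedness, so all inputs have their
  -- values at `βs`.
  have hpin : (∃ j, P.BusConditionA βs j) → ∀ j, P.ζ (β 0) j = P.ζ βs j := by
    rintro ⟨i, hi⟩ j
    have h1 : P.ζ (β 0) i - P.ζ βs i = 0 := by
      by_contra hne
      exact (hA i hi _ hne).ne' (hzero 0 i)
    have h2 : P.pc (β 0) i = P.pc βs i := sub_eq_zero.1 (congr_arg Prod.snd h1)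
    have h3 : P.pc (β 0) j = P.pc (β 0) i :=
      P.comm.eq_of_forall_edges (fun e => sub_eq_zero.1 (hedge 0 e)) j i
    simp only [ζ, hω, hωs, h3, h2, heq.pc_eq_pc j i, Pi.zero_apply]
  -- generation and controllable demand
  have hxM : ∀ t j, P.xM (β t) j = (P.gen j).kx (P.ζ (β 0) (.inl j)) := by
    intro t j
    refine eq_of_mem_regionOfAttraction ((P.gen j).locallyLipschitz_f (P.ζ (β 0) (.inl j)))
      ((P.gen j).stable _) (x := fun t => P.xM (β t) j) (fun t _ => ?_)
      (hC.image (f := fun β : P.State => P.xM β j) (by fun_prop)) ?_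
      (fun t => mem_image_of_mem _ (hβC t)) t
    · have := hβ.xM_deriv t (mem_univ t) j
      rwa [hζ] at this
    · rintro _ ⟨γ, hγ, rfl⟩
      exact hMattr j _ ((hCO (hβC 0)).2.1 j) (fun h => hpin h _) ((hCO hγ).1 j)
  have hxc : ∀ t j, P.xc (β t) j = (P.load j).kx (P.ζ (β 0) j) := by
    intro t j
    refine eq_of_mem_regionOfAttraction ((P.load j).locallyLipschitz_f (P.ζ (β 0) j))
      ((P.load j).stable _) (x := fun t => P.xc (β t) j) (fun t _ => ?_)
      (hC.image (f := fun β : P.State => P.xc β j) (by fun_prop)) ?_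
      (fun t => mem_image_of_mem _ (hβC t)) t
    · have := hβ.xc_deriv t (mem_univ t) j
      rwa [hζ] at this
    · rintro _ ⟨γ, hγ, rfl⟩
      exact hCattr j _ ((hCO (hβC 0)).2.2.2.1 j) (fun h => hpin h _) ((hCO hγ).2.2.1 j)
  intro t
  refine ⟨fun e => by rw [hω, hω, sub_zero], fun j => hbal t _, fun j => hbal t _, fun j => ?_,
    fun j => ?_, fun j => ?_, hedge t, fun j => ?_⟩
  · rw [(P.gen j).equilibrium_iff, hxM, hζ t]
  · rw [(P.load j).equilibrium_iff, hxc, hζ t]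
  · rw [(P.unc j).equilibrium_iff, hxu, hω, neg_zero]
  · have h1 := hasDerivWithinAt_univ.1 (hβ.pc_deriv t (mem_univ t) j)
    have h2 : (fun r => P.pc (β r) j) = fun _ => P.pc (β 0) j := funext fun r => hpc r j
    rw [h2] at h1
    exact (div_eq_zero_iff.1 (h1.unique (hasDerivAt_const t _))).resolve_right (P.γ_pos j).ne'

end PowerNetwork

end Invariance

/-! ### Passing between the differential-algebraic system and the reduced equation -/

section Reduction

namespace PowerNetwork

variable {G L : Type} [DecidableEq G] [DecidableEq L]
  {P : PowerNetwork G L} {B : Set P.DiffState} {W : Set (L → ℝ)} {w : P.DiffState → L → ℝ}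

theorem combine_eq_of_algebraicEquations
    (hw : ∀ β, P.diffPart β ∈ B → P.ωL β ∈ W →
      (P.AlgebraicEquations β ↔ P.ωL β = w (P.diffPart β)))
    {β : P.State} (hβ : P.AlgebraicEquations β) (hB : P.diffPart β ∈ B) (hW : P.ωL β ∈ W) :
    P.combine (P.diffPart β) (w (P.diffPart β)) = β := by
  rw [← (hw β hB hW).1 hβ, combine_diffPart]

variable [Fintype G] [Fintype L]

theorem IsSolution.mono {I J : Set ℝ} {β : ℝ → P.State} (hβ : P.IsSolution I β) (hJ : J ⊆ I) :
    P.IsSolution J β :=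
  isSolution_of_hasDerivWithinAt (fun _ ht => (hβ.hasDerivWithinAt_diffPart (hJ ht)).mono hJ)
    (hβ.continuousOn.mono hJ) fun t ht => hβ.algebraic t (hJ ht)

/-- Solutions of the differential-algebraic system solve the reduced differential equation. -/
theorem IsSolution.isODESolution_diffPart
    (hw : ∀ β, P.diffPart β ∈ B → P.ωL β ∈ W →
      (P.AlgebraicEquations β ↔ P.ωL β = w (P.diffPart β)))
    {I : Set ℝ} {β : ℝ → P.State} (hβ : P.IsSolution I β)
    (hmem : ∀ t ∈ I, P.diffPart (β t) ∈ B ∧ P.ωL (β t) ∈ W) :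
    IsODESolution (fun z => P.field (P.combine z (w z))) I fun t => P.diffPart (β t) := by
  intro t ht
  have h1 := hβ.hasDerivWithinAt_diffPart ht
  rw [← combine_eq_of_algebraicEquations hw (hβ.algebraic t ht) (hmem t ht).1 (hmem t ht).2] at h1
  exact h1

theorem isSolution_combine (hwc : ContinuousOn w B) (hwW : ∀ z ∈ B, w z ∈ W)
    (hw : ∀ β, P.diffPart β ∈ B → P.ωL β ∈ W →
      (P.AlgebraicEquations β ↔ P.ωL β = w (P.diffPart β)))
    {I : Set ℝ} {z : ℝ → P.DiffState}
    (hz : IsODESolution (fun z => P.field (P.combine z (w z))) I z) (hzB : ∀ t ∈ I, z t ∈ B) :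
    P.IsSolution I fun t => P.combine (z t) (w (z t)) :=
  isSolution_of_hasDerivWithinAt hz
    (P.continuous_combine.comp_continuousOn
      (hz.continuousOn.prodMk (hwc.comp hz.continuousOn hzB)))
    fun t ht => (hw (P.combine (z t) (w (z t))) (hzB t ht) (hwW _ (hzB t ht))).2 rfl

/-- Solutions that start in a sublevel set of a Lyapunov function inside a ball stay in the ball,
and their frequencies stay in the domain of the frequency map. -/
theorem IsSolution.mem_ball_of_lyapunov {zs : P.DiffState} {r : ℝ}
    (hW : IsOpen W) (hwc : ContinuousOn w (Metric.closedBall zs r))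
    (hwW : ∀ z ∈ Metric.closedBall zs r, w z ∈ W)
    (hw : ∀ β, P.diffPart β ∈ Metric.closedBall zs r → P.ωL β ∈ W →
      (P.AlgebraicEquations β ↔ P.ωL β = w (P.diffPart β)))
    {V : P.DiffState → ℝ} (hV : Differentiable ℝ V)
    (hVF : ∀ z ∈ Metric.closedBall zs r, fderiv ℝ V z (P.field (P.combine z (w z))) ≤ 0) {c : ℝ}
    (hc : ∀ z ∈ Metric.sphere zs r, c ≤ V z) {β : ℝ → P.State} {t : ℝ} (ht : 0 ≤ t)
    (hβ : P.IsSolution (Icc 0 t) β) (h0 : P.diffPart (β 0) ∈ Metric.ball zs r)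
    (h0c : V (P.diffPart (β 0)) < c) (h0W : P.ωL (β 0) ∈ W) :
    P.diffPart (β t) ∈ Metric.ball zs r ∧ P.ωL (β t) ∈ W := by
  have hO : IsOpen (P.diffPart ⁻¹' Metric.ball zs r ∩ P.ωL ⁻¹' W) :=
    (Metric.isOpen_ball.preimage P.continuous_diffPart).inter (hW.preimage P.continuous_ωL)
  -- Both memberships are propagated together: the reduced equation, hence the decrease of V, is
  -- available only while ω^L stays in W.
  refine mem_of_forall_Ico_mem hO ht hβ.continuousOn ⟨h0, h0W⟩ fun s hs hlt => ?_
  have hβs : P.IsSolution (Icc 0 s) β := hβ.mono (Icc_subset_Icc_right hs.2)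
  have hzc : ContinuousOn (fun t => P.diffPart (β t)) (Icc 0 s) :=
    P.continuous_diffPart.comp_continuousOn hβs.continuousOn
  have hzB : MapsTo (fun t => P.diffPart (β t)) (Icc 0 s) (Metric.closedBall zs r) := by
    have h1 : MapsTo (fun t => P.diffPart (β t)) (closure (Ico 0 s)) (closure (Metric.ball zs r)) :=
      MapsTo.closure_of_continuousOn (fun q hq => (hlt q hq).1) (by rwa [closure_Ico hs.1.ne])
    rw [closure_Ico hs.1.ne] at h1
    exact fun q hq => Metric.closure_ball_subset_closedBall (h1 hq)
  have hβs' : P.IsSolution (Ico 0 s) β := hβs.mono Ico_subset_Icc_self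
  have hIs := hβs'.isODESolution_diffPart hw
    fun q hq => ⟨hzB (Ico_subset_Icc_self hq), (hlt q hq).2⟩
  have hVle : V (P.diffPart (β s)) ≤ V (P.diffPart (β 0)) :=
    le_of_fderiv_nonpos hV hVF hs.1.le hIs hzc fun q hq => hzB (Ico_subset_Icc_self hq)
  have hsB := hzB (right_mem_Icc.2 hs.1.le)
  refine ⟨(Metric.mem_closedBall.1 hsB).lt_of_ne fun h => ?_, ?_⟩
  · exact absurd (hc _ h) (not_le.2 (hVle.trans_lt h0c))
  · have heqOn : EqOn (fun q => P.ωL (β q)) (fun q => w (P.diffPart (β q))) (Ico 0 s) :=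
      fun q hq => (hw (β q) (hzB (Ico_subset_Icc_self hq)) (hlt q hq).2).1 (hβs'.algebraic q hq)
    have h2 : P.ωL (β s) = w (P.diffPart (β s)) :=
      heqOn.of_subset_closure (P.continuous_ωL.comp_continuousOn hβs.continuousOn)
        (hwc.comp hzc hzB) Ico_subset_Icc_self (by rw [closure_Ico hs.1.ne])
        (right_mem_Icc.2 hs.1.le)
    change P.ωL (β s) ∈ W
    rw [h2]
    exact hwW _ hsB

end PowerNetwork

end Reduction

/-! ### The convergence theorem -/

theorem theorem2 {G L : Type} [Fintype G] [Fintype L] [DecidableEq G] [DecidableEq L]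
    (P : PowerNetwork G L) (D : OSLCData G L)
    -- the costs are continuously differentiable and strictly convex
    (hC : ∀ j, ContDiff ℝ 1 (D.C j) ∧ StrictConvexOn ℝ Set.univ (D.C j))
    (hCd : ∀ j, ContDiff ℝ 1 (D.Cd j) ∧ StrictConvexOn ℝ Set.univ (D.Cd j))
    -- the sign condition on the steady-state uncontrollable demand
    (hdu : ∀ j, ∀ u : ℝ, u ≠ 0 → 0 < u * (P.unc j).ky u)
    -- the saturated marginal-cost condition
    (hcont : D.SaturatedMarginalCost P)
    -- the equilibrium under consideration
    (βs : P.State) (heq : P.IsEquilibrium βs)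
    (hη : ∀ e, |P.η βs e| < Real.pi / 2)
    (hL : P.HasLocalFrequencyMap βs)
    (hdiss : ∀ j, P.BusConditionA βs j ∨ P.BusConditionB βs j)
    (hX₀ : (∀ j, ¬ P.BusConditionA βs j) → P.HasCommonRegionsOfAttraction βs) :
    ∃ (S K : Set P.State), IsOpen S ∧ βs ∈ S ∧ IsCompact K ∧ βs ∈ K ∧
      -- `K` consists of equilibria with zero frequency that solve the OSLC problem
      (∀ β ∈ K, P.IsEquilibrium β ∧ P.ω β = 0 ∧ D.IsOptimal P.pL (P.pM β, P.dc β)) ∧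
      -- from each consistent initial condition in `S` there is a solution for all times `t ≥ 0`
      (∀ β₀ ∈ S, P.AlgebraicEquations β₀ →
        ∃ β : ℝ → P.State, P.IsSolution (Set.Ici 0) β ∧ β 0 = β₀) ∧
      -- no solution from `S` ends in finite time
      (∀ τ > 0, ∀ β : ℝ → P.State, P.IsSolution (Set.Ico 0 τ) β → β 0 ∈ S →
        ∃ β' : ℝ → P.State, P.IsSolution (Set.Ici 0) β' ∧ Set.EqOn β' β (Set.Ico 0 τ)) ∧
      -- every solution from `S` converges to `K`
      (∀ β : ℝ → P.State, P.IsSolution (Set.Ici 0) β → β 0 ∈ S →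
        Filter.Tendsto β Filter.atTop (nhdsSet K)) := by
  have hωs : P.ω βs = 0 := heq.ω_eq_zero hdu
  choose φ U hU hφ0 hφ1 hA hB using fun j => P.exists_busStorage (hdiss j)
  obtain ⟨O, hO, hinv⟩ := PowerNetwork.isEquilibrium_of_complete heq hωs hφ1 hA hB hX₀
  obtain ⟨T, W, fL, hT, hTs, hW, hWs, hlip, hiff⟩ := hL
  let zs := P.diffPart βs
  obtain ⟨V, hVdef⟩ : ∃ V, V = PowerNetwork.lyapunov βs U := ⟨_, rfl⟩
  have hV : Differentiable ℝ V :=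
    hVdef ▸ PowerNetwork.differentiable_lyapunov fun j => (hU j).differentiable
  have hVle := PowerNetwork.fderiv_lyapunov_le heq hωs hU
  have hVlt := PowerNetwork.lyapunov_lt hη hU
  rw [← hVdef] at hVle hVlt
  let emb : P.DiffState → P.State := fun z => P.combine z (fL (P.reducedDiff z))
  -- the algebraic equations determine the frequencies at the buses without inertia
  have hembs : emb zs = βs := by
    have h1 : P.ωL βs = fL (P.reduced βs) := (hiff βs hTs hWs).1 heq.algebraic
    have h2 := P.combine_diffPart βs
    rwa [h1] at h2
  have hfLc : ContinuousOn (fun z => fL (P.reducedDiff z)) (P.reducedDiff ⁻¹' T) :=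
    hlip.continuousOn.comp P.continuous_reducedDiff.continuousOn fun _ hz => hz
  have hT' : P.reducedDiff ⁻¹' T ∈ 𝓝 zs :=
    (hT.preimage P.continuous_reducedDiff).mem_nhds hTs
  have hembc : ContinuousOn emb (P.reducedDiff ⁻¹' T) :=
    P.continuous_combine.comp_continuousOn (continuousOn_id.prodMk hfLc)
  have hemb_tendsto : Tendsto emb (𝓝 zs) (𝓝 βs) := by
    have := (hembc.continuousAt hT').tendsto
    rwa [hembs] at this
  have hfLW : ∀ᶠ z in 𝓝 zs, fL (P.reducedDiff z) ∈ W := by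
    filter_upwards [((P.continuous_ωL.continuousAt (x := βs)).tendsto.comp
      hemb_tendsto).eventually (hW.mem_nhds hWs)] with z hz using hz
  have hall := (eventually_mem_set.2 hT').and <| hfLW.and <| (hemb_tendsto.eventually hO).and <|
    (hemb_tendsto.eventually hVle).and hVlt
  obtain ⟨r, hr, hball⟩ := Metric.nhds_basis_closedBall.eventually_iff.1 hall
  have hembB : ContinuousOn emb (Metric.closedBall zs r) := hembc.mono fun z hz => (hball hz).1
  have hcompact : IsCompact (Metric.closedBall zs r) := isCompact_closedBall zs r
  have halg : ∀ z ∈ Metric.closedBall zs r, P.AlgebraicEquations (emb z) := fun z hz =>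
    (hiff (emb z) (hball hz).1 (hball hz).2.1).2 rfl
  let F : P.DiffState → P.DiffState := fun z => P.field (emb z)
  have hF : ContinuousOn F (Metric.closedBall zs r) := P.continuous_field.comp_continuousOn hembB
  have hVφ : ∀ z ∈ Metric.closedBall zs r,
      fderiv ℝ V z (F z) ≤ -∑ j, φ j (P.ζ (emb z) j - P.ζ βs j) := fun z hz =>
    (hball hz).2.2.2.1 (halg z hz)
  have hVF : ∀ z ∈ Metric.closedBall zs r, fderiv ℝ V z (F z) ≤ 0 := fun z hz =>
    (hVφ z hz).trans (neg_nonpos.2 (Finset.sum_nonneg fun j _ => hφ0 j _))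
  -- The level c is the minimum of V on the sphere, which exceeds V zs by strictness. The sphere is
  -- empty if the state space is trivial; then any larger level will do.
  obtain ⟨c, hcs, hc⟩ : ∃ c, V zs < c ∧ ∀ z ∈ Metric.sphere zs r, c ≤ V z := by
    rcases (Metric.sphere zs r).eq_empty_or_nonempty with h | h
    · exact ⟨V zs + 1, by linarith, by simp [h]⟩
    · obtain ⟨z, hz, hmin⟩ := (isCompact_sphere zs r).exists_isMinOn h hV.continuous.continuousOn
      exact ⟨V z, (hball (Metric.sphere_subset_closedBall hz)).2.2.2.2
        (Metric.ne_of_mem_sphere hz hr.ne'), hmin⟩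
  have hmem_ball : ∀ z ∈ Metric.closedBall zs r, V z < c → z ∈ Metric.ball zs r := by
    intro z hz hVz
    refine (Metric.mem_closedBall.1 hz).lt_of_ne fun h => ?_
    exact absurd (hc z h) (not_le.2 hVz)
  let w : P.DiffState → L → ℝ := fun z => fL (P.reducedDiff z)
  have hwc : ContinuousOn w (Metric.closedBall zs r) := hfLc.mono fun z hz => (hball hz).1
  have hwW : ∀ z ∈ Metric.closedBall zs r, w z ∈ W := fun z hz => (hball hz).2.1
  have hw : ∀ β, P.diffPart β ∈ Metric.closedBall zs r → P.ωL β ∈ W →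
      (P.AlgebraicEquations β ↔ P.ωL β = w (P.diffPart β)) := fun β hβ hβW =>
    hiff β (hball hβ).1 hβW
  have hsol : ∀ (I : Set ℝ) (z : ℝ → P.DiffState), IsODESolution F I z →
      (∀ t ∈ I, z t ∈ Metric.closedBall zs r) → P.IsSolution I fun t => emb (z t) :=
    fun I z hz hzB => PowerNetwork.isSolution_combine hwc hwW hw hz hzB
  have hemb_eq : ∀ β : P.State, P.AlgebraicEquations β →
      P.diffPart β ∈ Metric.ball zs r → P.ωL β ∈ W → emb (P.diffPart β) = β :=
    fun β hβ hz hβW => PowerNetwork.combine_eq_of_algebraicEquations hw hβ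
      (Metric.ball_subset_closedBall hz) hβW
  let S : Set P.State := {β | P.diffPart β ∈ Metric.ball zs r ∧ V (P.diffPart β) < c ∧ P.ωL β ∈ W}
  have hSo : IsOpen S :=
    (Metric.isOpen_ball.preimage P.continuous_diffPart).inter
      ((isOpen_lt (hV.continuous.comp P.continuous_diffPart) continuous_const).inter
        (hW.preimage P.continuous_ωL))
  have hode : ∀ (I : Set ℝ) (β : ℝ → P.State), P.IsSolution I β →
      (∀ t ∈ I, P.diffPart (β t) ∈ Metric.ball zs r ∧ P.ωL (β t) ∈ W) →
      IsODESolution F I fun t => P.diffPart (β t) := fun I β hβ hmem =>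
    hβ.isODESolution_diffPart hw fun t ht =>
      ⟨Metric.ball_subset_closedBall (hmem t ht).1, (hmem t ht).2⟩
  have htrap : ∀ (I : Set ℝ) (β : ℝ → P.State), P.IsSolution I β → β 0 ∈ S →
      ∀ t, 0 ≤ t → Icc 0 t ⊆ I → P.diffPart (β t) ∈ Metric.ball zs r ∧ P.ωL (β t) ∈ W :=
    fun I β hβ h0 t ht hI =>
      (hβ.mono hI).mem_ball_of_lyapunov hW hwc hwW hw hV hVF hc ht h0.1 h0.2.1 h0.2.2
  -- K is the image of the zeros of F in the closed ball: this set is compact, and it corresponds to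
  -- the equilibria there.
  let KZ : Set P.DiffState := Metric.closedBall zs r ∩ F ⁻¹' {0}
  have hKZ : IsCompact KZ := hcompact.of_isClosed_subset
    (hF.preimage_isClosed_of_isClosed Metric.isClosed_closedBall isClosed_singleton) inter_subset_left
  have hKZeq : ∀ z ∈ Metric.closedBall zs r, z ∈ KZ ↔ P.IsEquilibrium (emb z) := fun z hz => by
    rw [PowerNetwork.isEquilibrium_iff]
    exact ⟨fun h => ⟨h.2, halg z hz⟩, fun h => ⟨hz, h.1⟩⟩
  have hzsB : zs ∈ Metric.closedBall zs r := Metric.mem_closedBall_self hr.le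
  refine ⟨S, emb '' KZ, hSo, ⟨Metric.mem_ball_self hr, hcs, hWs⟩,
    hKZ.image_of_continuousOn (hembB.mono inter_subset_left),
    ⟨zs, (hKZeq zs hzsB).2 (hembs ▸ heq), hembs⟩, ?_, ?_, ?_, ?_⟩
  · rintro _ ⟨z, hz, rfl⟩
    have he : P.IsEquilibrium (emb z) := (hKZeq z hz.1).1 hz
    exact ⟨he, he.ω_eq_zero hdu, he.isOptimal hC hCd hcont (he.ω_eq_zero hdu)⟩
  · intro β₀ h0 ha
    obtain ⟨z, hz, hz0, hzB⟩ := exists_isODESolution_of_lyapunov hr hF hV hVF hc h0.1 h0.2.1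
    refine ⟨fun t => emb (z t), hsol _ z hz fun t ht =>
      Metric.ball_subset_closedBall (hzB t ht).1, ?_⟩
    change emb (z 0) = β₀
    rw [hz0]
    exact hemb_eq β₀ ha h0.1 h0.2.2
  · intro τ hτ β hβ h0
    have hmem : ∀ t ∈ Ico 0 τ, P.diffPart (β t) ∈ Metric.ball zs r ∧ P.ωL (β t) ∈ W :=
      fun t ht => htrap _ β hβ h0 t ht.1 fun s hs => ⟨hs.1, hs.2.trans_lt ht.2⟩
    have hz := hode _ β hβ hmem
    obtain ⟨y, hy, hyz, hyB⟩ := exists_isODESolution_extension_of_lyapunov hr hF hV hVF hc hτ hz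
      (fun t ht => Metric.ball_subset_closedBall (hmem t ht).1) h0.2.1
    refine ⟨fun t => emb (y t), hsol _ y hy hyB, fun t ht => ?_⟩
    change emb (y t) = β t
    rw [hyz ht]
    exact hemb_eq _ (hβ.algebraic t ht) (hmem t ht).1 (hmem t ht).2
  · intro β hβ h0
    have hmem : ∀ t ∈ Ici (0 : ℝ), P.diffPart (β t) ∈ Metric.ball zs r ∧ P.ωL (β t) ∈ W :=
      fun t ht => htrap _ β hβ h0 t ht Icc_subset_Ici_self
    have hz := hode _ β hβ hmem
    have hzB : ∀ t ≥ 0, P.diffPart (β t) ∈ Metric.closedBall zs r := fun t ht =>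
      Metric.ball_subset_closedBall (hmem t ht).1
    have hlim : Tendsto (fun t => P.diffPart (β t)) atTop (𝓝ˢ KZ) := by
      refine tendsto_nhdsSet_of_antitoneOn hcompact hF hz hzB hV.continuous.continuousOn
        (antitoneOn_of_fderiv_nonpos hV hVF (convex_Ici 0) interior_subset hz hz.continuousOn hzB)
        fun y hy hyB ⟨v, hv⟩ => ?_
      refine (hKZeq _ (hyB 0)).2 (hinv (emb '' Metric.closedBall zs r) ?_
        (hcompact.image_of_continuousOn hembB) (fun t => emb (y t))
        (hsol _ y hy fun t _ => hyB t) (fun t => mem_image_of_mem _ (hyB t)) (fun t => ?_) 0)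
      · rintro _ ⟨z, hz, rfl⟩
        exact (hball hz).2.2.1
      -- As V is constant along y, 0 ≤ −Σφ_j with all φ_j ≥ 0, so every φ_j vanishes.
      · have h1 : HasDerivAt (fun t => V (y t)) (fderiv ℝ V (y t) (F (y t))) t :=
          (hV (y t)).hasFDerivAt.comp_hasDerivAt t (hasDerivWithinAt_univ.1 (hy t (mem_univ t)))
        rw [show (fun t => V (y t)) = fun _ => v from funext hv] at h1
        have h2 := hVφ (y t) (hyB t)
        rw [h1.unique (hasDerivAt_const t v)] at h2
        have h3 := (Finset.sum_eq_zero_iff_of_nonneg fun j _ => hφ0 j _).1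
          (le_antisymm (by linarith) (Finset.sum_nonneg fun j _ =>
            hφ0 j (P.ζ (emb (y t)) j - P.ζ βs j)))
        exact fun j => h3 j (Finset.mem_univ j)
    refine tendsto_iff_forall_eventually_mem.2 fun N hN => ?_
    obtain ⟨Q, hQ, hKQ, hQN⟩ := mem_nhdsSet_iff_exists.1 hN
    -- Continuity of `emb` is known on the closed ball only, so the preimage of Q is open relative
    -- to the ball and is replaced by an open Q' with the same trace.
    obtain ⟨Q', hQ', hQeq⟩ := continuousOn_iff'.1 hembB Q hQ
    have hKQ' : KZ ⊆ Q' := fun z hz => (hQeq ▸ (⟨hKQ (mem_image_of_mem emb hz), hz.1⟩ :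
      z ∈ emb ⁻¹' Q ∩ Metric.closedBall zs r) : z ∈ Q' ∩ Metric.closedBall zs r).1
    filter_upwards [hlim (hQ'.mem_nhdsSet.2 hKQ'), eventually_ge_atTop 0] with t ht ht0
    have h1 : P.diffPart (β t) ∈ emb ⁻¹' Q ∩ Metric.closedBall zs r := hQeq ▸ ⟨ht, hzB t ht0⟩
    have h2 : emb (P.diffPart (β t)) ∈ Q := h1.1
    rw [hemb_eq _ (hβ.algebraic t ht0) (hmem t ht0).1 (hmem t ht0).2] at h2
    exact hQN h2
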